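/- Let $(Z,d,\mu)$ be a metric measure space, i.e. $(Z,d)$ is a separable metric space and $\mu$ is a Borel regular measure with $0<\mu(B(z,r))<\infty$ for all $z\in Z$, $0<r<\infty$. Let $\Omega\subset Z$ be complete, equipped with the restricted distance and the restricted measure. Suppose that ${\rm LIP}^{\infty}(\Omega)=W^{1,\infty}(\Omega)$ (for real-valued functions, as subsets of $L^\infty(\Omega)$) and that $\Omega$ or $Z\setminus\Omega$ has finite Nagata dimension. Then for every (real) Banach space $\mathbb V$ there exists a bounded linear extension operator $$E_{\mathbb V}\colon W^{1,\infty}(\Omega;\mathbb V)\to {\rm LIP}^{\infty}(Z;\mathbb V),$$ i.e. a linear map such that $(E_{\mathbb V}u)|_\Omega=u$ almost everywhere in $\Omega$ for every $u$, and such that for some constant $C<\infty$, $\|E_{\mathbb V}u\|_{{\rm LIP}^{\infty}(Z;\mathbb V)}\le C\|u\|_{W^{1,\infty}(\Omega;\mathbb V)}$ for every $u$. Here, for $X\in\{\Omega,Z\}$ with its metric and measure: * ${\rm LIP}^\infty(X;\mathbb V)$ is the space of essentially bounded Lipschitz maps $f\colon X\to\mathbb V$, with norm $\|f\|_{L^\infty(X)}+{\rm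 lip}(f)$, where ${\rm lip}(f)$ is the smallest Lipschitz constant of $f$. * A family $\Gamma$ of curves (continuous maps of compact intervals into $X$) is $\infty$-negligible if there is a Borel function $\rho\colon X\to[0,\infty]$ with $\|\rho\|_{L^\infty(X)}=0$ and $\int_\gamma\rho\,ds=\infty$ for every rectifiable $\gamma\in\Gamma$; the integral is taken with respect to the unit speed reparametrization of $\gamma$. A Borel function $\rho\colon X\to[0,\infty]$ is an $\infty$-weak upper gradient of $v\colon X\to\mathbb V$ if $|v(\gamma(a))-v(\gamma(b))|\le\int_\gamma\rho\,ds$ for all nonconstant curves $\gamma\colon[a,b]\to X$ outside an $\infty$-negligible family. * $W^{1,\infty}(X;\mathbb V)$ is the space of all $u\in L^\infty(X;\mathbb V)$ (classes of Bochner measurable, essentially bounded maps) that have a representative with an essentially bounded $\infty$-weak upper gradient, with norm $\|u\|_{L^\infty(X)}+\inf\|\rho\|_{L^\infty(X)}$, the infimum over all $\infty$-weak upper gradients $\rho$ of representatives of $u$. For $\mathbb V=\mathbb R$ the target is omitted from the notation. * The Nagata dimension of a metric space $X$ is the infimum of all integers $n\ge0$ for which there is $c>0$ such that for all $s>0$ there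 is a covering $X=\bigcup_{i\in I}D_i$ with ${\rm diam}(D_i)\le cs$ for all $i$ and such that every $D\subset X$ with ${\rm diam}(D)\le s$ meets at most $n+1$ of the sets $D_i$. -/

import Mathlib

open MeasureTheory Set
open scoped ENNReal NNReal

noncomputable section

namespace MetricSobolev

/-! ### Nagata dimension -/

/-- `X` has Nagata dimension at most `n`: for some `c > 0` and every scale `s > 0` there is a
covering of `X` by sets of diameter at most `c * s` such that every set of diameter at most `s`
meets at most `n + 1` members of the covering. -/
def NagataDimLE (X : Type*) [MetricSpace X] (n : ℕ) : Prop :=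
  ∃ c : ℝ, 0 < c ∧ ∀ s : ℝ, 0 < s → ∃ 𝒟 : Set (Set X),
    ⋃₀ 𝒟 = univ ∧
    (∀ D ∈ 𝒟, Metric.ediam D ≤ ENNReal.ofReal (c * s)) ∧
    ∀ A : Set X, Metric.ediam A ≤ ENNReal.ofReal s →
      {D ∈ 𝒟 | (A ∩ D).Nonempty}.encard ≤ (n : ℕ∞) + 1

/-- The Nagata dimension of a metric space, with value `⊤` if it is not finite. -/
def nagataDim (X : Type*) [MetricSpace X] : ℕ∞ :=
  sInf {m : ℕ∞ | ∃ n : ℕ, m = n ∧ NagataDimLE X n}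

/-! ### Curves and curve integrals -/

/-- A curve in `X`: a continuous map on a compact interval `[left, right]`
(the values of `toFun` outside the interval play no role). -/
structure Curve (X : Type*) [TopologicalSpace X] where
  left : ℝ
  right : ℝ
  left_le_right : left ≤ right
  toFun : ℝ → X
  continuousOn : ContinuousOn toFun (Icc left right)

section Curve

variable {X : Type*} [MetricSpace X]

/-- The length of a curve. -/
def Curve.length (γ : Curve X) : ℝ≥0∞ := eVariationOn γ.toFun (Icc γ.left γ.right)

def Curve.Rectifiable (γ : Curve X) : Prop := γ.length ≠ ∞

def Curve.Nonconstant (γ : Curve X) : Prop :=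
  ∃ s ∈ Icc γ.left γ.right, ∃ t ∈ Icc γ.left γ.right, γ.toFun s ≠ γ.toFun t

/-- The unit speed reparametrization of a rectifiable curve, a map on `[0, length γ]`. -/
def Curve.unitSpeed (γ : Curve X) : ℝ → X :=
  naturalParameterization γ.toFun (Icc γ.left γ.right) γ.left

/-- The integral of `ρ` over a rectifiable curve. -/
def Curve.integral (γ : Curve X) (ρ : X → ℝ≥0∞) : ℝ≥0∞ :=
  ∫⁻ s in Icc 0 γ.length.toReal, ρ (γ.unitSpeed s)

end Curve

/-! ### Weak upper gradients -/

section Gradient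

variable {X : Type*} [MetricSpace X] [MeasurableSpace X]

/-- A family of curves is `∞`-negligible if there is a Borel function `ρ ≥ 0` with vanishing
`L^∞`-norm whose integral over every rectifiable curve of the family is infinite. -/
def Negligible (μ : Measure X) (Γ : Set (Curve X)) : Prop :=
  ∃ ρ : X → ℝ≥0∞, Measurable ρ ∧ essSup ρ μ = 0 ∧
    ∀ γ ∈ Γ, γ.Rectifiable → γ.integral ρ = ∞

variable {V : Type*} [NormedAddCommGroup V]

/-- `ρ` is an `∞`-weak upper gradient of `u`: it is Borel and the upper gradient inequality holds
for all nonconstant curves outside an `∞`-negligible family (to which all nonrectifiable curves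
may be taken to belong). -/
def IsWeakUpperGradient (μ : Measure X) (u : X → V) (ρ : X → ℝ≥0∞) : Prop :=
  Measurable ρ ∧
  Negligible μ {γ : Curve X | γ.Nonconstant ∧
    ¬ ‖u (γ.toFun γ.left) - u (γ.toFun γ.right)‖ₑ ≤ γ.integral ρ}

theorem Negligible.union {μ : Measure X} {Γ₁ Γ₂ : Set (Curve X)}
    (h₁ : Negligible μ Γ₁) (h₂ : Negligible μ Γ₂) : Negligible μ (Γ₁ ∪ Γ₂) := by
  obtain ⟨ρ₁, m₁, z₁, i₁⟩ := h₁
  obtain ⟨ρ₂, m₂, z₂, i₂⟩ := h₂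
  refine ⟨ρ₁ + ρ₂, m₁.add m₂, ?_, ?_⟩
  · exact le_antisymm ((ENNReal.essSup_add_le ρ₁ ρ₂).trans (by simp [z₁, z₂])) bot_le
  · rintro γ (h | h) hr
    · exact top_le_iff.1 ((i₁ γ h hr).symm.le.trans
        (lintegral_mono fun s => le_self_add))
    · exact top_le_iff.1 ((i₂ γ h hr).symm.le.trans
        (lintegral_mono fun s => le_add_self))

theorem Negligible.mono {μ : Measure X} {Γ₁ Γ₂ : Set (Curve X)}
    (h₂ : Negligible μ Γ₂) (h : Γ₁ ⊆ Γ₂) : Negligible μ Γ₁ := by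
  obtain ⟨ρ₂, m₂, z₂, i₂⟩ := h₂
  exact ⟨ρ₂, m₂, z₂, fun γ hγ => i₂ γ (h hγ)⟩

theorem IsWeakUpperGradient.add {μ : Measure X} {u₁ u₂ : X → V} {ρ₁ ρ₂ : X → ℝ≥0∞}
    (h₁ : IsWeakUpperGradient μ u₁ ρ₁) (h₂ : IsWeakUpperGradient μ u₂ ρ₂) :
    IsWeakUpperGradient μ (u₁ + u₂) (ρ₁ + ρ₂) := by
  refine ⟨h₁.1.add h₂.1, (h₁.2.union h₂.2).mono ?_⟩
  rintro γ ⟨hc, hγ⟩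
  by_contra hcon
  simp only [mem_union, mem_ofPred_eq, hc, true_and, not_or, not_not] at hcon
  refine hγ (le_trans ?_ (le_lintegral_add _ _))
  refine le_trans ?_ (add_le_add hcon.1 hcon.2)
  refine le_trans (le_of_eq ?_) (enorm_add_le _ _)
  congr 1
  simp only [Pi.add_apply]
  abel

theorem IsWeakUpperGradient.smul [NormedSpace ℝ V] {μ : Measure X} {u : X → V} {ρ : X → ℝ≥0∞}
    (h : IsWeakUpperGradient μ u ρ) (c : ℝ) :
    IsWeakUpperGradient μ (c • u) (fun x => ‖c‖ₑ * ρ x) := by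
  refine ⟨h.1.const_mul _, h.2.mono ?_⟩
  rintro γ ⟨hc, hγ⟩
  refine ⟨hc, fun hle => hγ ?_⟩
  refine le_trans ?_ (lintegral_const_mul_le _ _)
  simp only [Pi.smul_apply, ← smul_sub, enorm_smul]
  gcongr
  exact hle

theorem IsWeakUpperGradient.zero (μ : Measure X) :
    IsWeakUpperGradient μ (0 : X → V) 0 :=
  ⟨measurable_const, 0, measurable_const, essSup_const_bot (μ := μ) (β := ℝ≥0∞),
    fun γ hγ => (hγ.2 (by simp)).elim⟩

end Gradient

/-! ### The function spaces -/

section Spaces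

variable {X : Type*} [MetricSpace X] [MeasurableSpace X]

/-- The Sobolev space `W^{1,∞}(X; V)`: the classes `u` in `L^∞(X; V)` with a representative `v`
that has an essentially bounded `∞`-weak upper gradient. -/
def sobolev (μ : Measure X) (V : Type*) [NormedAddCommGroup V] [NormedSpace ℝ V] :
    Submodule ℝ (Lp V ∞ μ) where
  carrier := {u | ∃ (v : X → V) (ρ : X → ℝ≥0∞),
    v =ᵐ[μ] u ∧ IsWeakUpperGradient μ v ρ ∧ essSup ρ μ < ∞}
  add_mem' := by
    rintro u₁ u₂ ⟨v₁, ρ₁, e₁, g₁, b₁⟩ ⟨v₂, ρ₂, e₂, g₂, b₂⟩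
    refine ⟨v₁ + v₂, ρ₁ + ρ₂, (e₁.add e₂).trans (Lp.coeFn_add u₁ u₂).symm, g₁.add g₂, ?_⟩
    exact (ENNReal.essSup_add_le ρ₁ ρ₂).trans_lt (ENNReal.add_lt_top.2 ⟨b₁, b₂⟩)
  zero_mem' := by
    refine ⟨0, 0, (Lp.coeFn_zero V ∞ μ).symm, IsWeakUpperGradient.zero μ, ?_⟩
    refine lt_of_eq_of_lt (b := (0 : ℝ≥0∞)) ?_ ENNReal.zero_lt_top
    exact essSup_const_bot (μ := μ) (β := ℝ≥0∞)
  smul_mem' := by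
    rintro c u ⟨v, ρ, e, g, b⟩
    refine ⟨c • v, _, (e.const_smul c).trans (Lp.coeFn_smul c u).symm, g.smul c, ?_⟩
    rw [ENNReal.essSup_const_mul]
    exact ENNReal.mul_lt_top (by simp) b

/-- The Newtonian energy seminorm: the infimum of the `L^∞`-norms of the `∞`-weak upper gradients
of the representatives of `u`. -/
def sobolevEnergy {μ : Measure X} {V : Type*} [NormedAddCommGroup V] (u : Lp V ∞ μ) : ℝ≥0∞ :=
  ⨅ (v : X → V) (ρ : X → ℝ≥0∞) (_ : v =ᵐ[μ] u ∧ IsWeakUpperGradient μ v ρ), essSup ρ μ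

/-- The norm of `W^{1,∞}(X; V)`. -/
def sobolevNorm {μ : Measure X} {V : Type*} [NormedAddCommGroup V] (u : Lp V ∞ μ) : ℝ≥0∞ :=
  eLpNorm u ∞ μ + sobolevEnergy u

/-- The smallest Lipschitz constant of `f` (`⊤` if `f` is not Lipschitz). -/
def lipConst {V : Type*} [NormedAddCommGroup V] (f : X → V) : ℝ≥0∞ :=
  ⨅ (K : ℝ≥0) (_ : LipschitzWith K f), (K : ℝ≥0∞)

/-- The norm of `LIP^∞(X; V)`. -/
def lipNorm (μ : Measure X) {V : Type*} [NormedAddCommGroup V] (f : X → V) : ℝ≥0∞ :=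
  eLpNorm f ∞ μ + lipConst f

/-- The space `LIP^∞(X; V)` of essentially bounded Lipschitz maps. -/
def lip (μ : Measure X) (V : Type*) [NormedAddCommGroup V] [NormedSpace ℝ V] :
    Submodule ℝ (X → V) where
  carrier := {f | (∃ K : ℝ≥0, LipschitzWith K f) ∧ eLpNorm f ∞ μ < ∞}
  add_mem' := by
    rintro f g ⟨⟨K, hf⟩, bf⟩ ⟨⟨L, hg⟩, bg⟩
    refine ⟨⟨K + L, hf.add hg⟩, ?_⟩
    rw [eLpNorm_exponent_top] at *
    exact eLpNormEssSup_add_le.trans_lt (ENNReal.add_lt_top.2 ⟨bf, bg⟩)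
  zero_mem' := ⟨⟨0, LipschitzWith.const 0⟩, by simp⟩
  smul_mem' := by
    rintro c f ⟨⟨K, hf⟩, bf⟩
    refine ⟨⟨‖c‖₊ * K, (lipschitzWith_smul c).comp hf⟩, ?_⟩
    rw [eLpNorm_const_smul]
    exact ENNReal.mul_lt_top (by simp) bf

/-- `LIP^∞(X) = W^{1,∞}(X)` for real-valued functions, as subsets of `L^∞(X)`. -/
def LipEqSobolev (μ : Measure X) : Prop :=
  ∀ u : Lp ℝ ∞ μ, u ∈ sobolev μ ℝ ↔ ∃ f ∈ lip μ ℝ, f =ᵐ[μ] u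

end Spaces

/-- A subset `Ω` with the restricted distance carries the restriction of `μ`. -/
def restrictTo {Z : Type*} [MeasurableSpace Z] (μ : Measure Z) (Ω : Set Z) : Measure Ω :=
  μ.comap (Subtype.val : Ω → Z)

end MetricSobolev

end

/-! The extension is a Whitney extension from `S`, the support of the measure restricted to `Ω`;
almost every point of `Ω` lies in `S`. Two things are needed: a linear choice of representatives
that are Lipschitz on `S` with a uniform bound, and a partition of unity off `S` with bounded
multiplicity.

For the representatives, the equality of sets `LIP^∞ = W^{1,∞}` is made quantitative. Real `W^{1,∞}`
is a Banach space, and the difference quotients over pairs of points of the support are continuous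
functionals, bounded pointwise because each class has a Lipschitz representative. Banach–Steinhaus
gives one constant for all classes (`LipEqSobolev.exists_bound_real`). A vector-valued class is
essentially separably valued, so countably many functionals of norm at most one carry the bound over
with the same constant (`LipEqSobolev.exists_bound`). Completeness of `V` extends the function from
a set of full measure to the support, where a continuous representative is unique; uniqueness yields
linearity.

Completeness of `W^{1,∞}` rests on `sobolevEnergy_tsum_le`: a series of representatives converges
along every curve that spends no time in a suitable null set.

For the partition, take `T = Ω` or `T = Ωᶜ`, whichever has finite Nagata dimension. Every `x ∉ S`
has a point of `T` within twice its distance to `S`: for `Ω` because `S ⊆ Ω`, for `Ωᶜ` because balls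
have positive measure. Pulling the Nagata coverings of `T` back along this choice, with scale
comparable to the distance to `S`, gives a Whitney covering of the complement of `S`. -/

namespace MetricSobolev

open Filter Topology

/-! ### Rectifiable curves, arc length, and time spent in a null set. -/

section Curves

variable {X : Type*} [MetricSpace X]

/-- The arc length function of a curve. -/
noncomputable def Curve.arcLength (γ : Curve X) : ℝ → ℝ :=
  variationOnFromTo γ.toFun (Icc γ.left γ.right) γ.left

theorem Curve.left_mem (γ : Curve X) : γ.left ∈ Icc γ.left γ.right := ⟨le_rfl, γ.left_le_right⟩

theorem Curve.right_mem (γ : Curve X) : γ.right ∈ Icc γ.left γ.right := ⟨γ.left_le_right, le_rfl⟩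

theorem Curve.Rectifiable.boundedVariationOn {γ : Curve X} (hγ : γ.Rectifiable) :
    BoundedVariationOn γ.toFun (Icc γ.left γ.right) := hγ

theorem Curve.Rectifiable.locallyBoundedVariationOn {γ : Curve X} (hγ : γ.Rectifiable) :
    LocallyBoundedVariationOn γ.toFun (Icc γ.left γ.right) :=
  hγ.boundedVariationOn.locallyBoundedVariationOn

theorem Curve.arcLength_left (γ : Curve X) : γ.arcLength γ.left = 0 :=
  variationOnFromTo.self _ _ _

theorem Curve.arcLength_eq (γ : Curve X) {t : ℝ} (ht : t ∈ Icc γ.left γ.right) :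
    γ.arcLength t = (eVariationOn γ.toFun (Icc γ.left t)).toReal := by
  rw [Curve.arcLength, variationOnFromTo.eq_of_le _ _ ht.1, Icc_inter_Icc, sup_idem,
    inf_eq_right.2 ht.2]

theorem Curve.arcLength_right (γ : Curve X) : γ.arcLength γ.right = γ.length.toReal :=
  γ.arcLength_eq γ.right_mem

theorem Curve.Rectifiable.continuousOn_arcLength {γ : Curve X} (hγ : γ.Rectifiable) :
    ContinuousOn γ.arcLength (Icc γ.left γ.right) := by
  intro x hx
  set s := Icc γ.left γ.right
  have hb := hγ.boundedVariationOn
  have hc : ContinuousWithinAt γ.toFun s x := γ.continuousOn x hx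
  have h1 := hb.tendsto_eVariationOn_Icc_zero_left (hc.mono inter_subset_left)
  have h2 := hb.tendsto_eVariationOn_Icc_zero_right x (hc.mono inter_subset_left)
  have h3 := (ENNReal.tendsto_toReal ENNReal.zero_ne_top).comp h1
  have h4 := (ENNReal.tendsto_toReal ENNReal.zero_ne_top).comp h2
  have h5 := h3.add h4
  simp only [ENNReal.toReal_zero, add_zero] at h5
  -- One of the two one-sided variations is the increment of arc length and the other is
  -- nonnegative, so their sum dominates on both sides of `x`.
  refine tendsto_iff_dist_tendsto_zero.2 (squeeze_zero' (.of_forall fun _ => dist_nonneg) ?_ h5)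
  filter_upwards [self_mem_nhdsWithin] with y hy
  rw [Real.dist_eq, Curve.arcLength,
    variationOnFromTo.sub_right hγ.locallyBoundedVariationOn γ.left_mem hy hx]
  simp only [Function.comp_apply]
  rcases le_total x y with h | h
  · rw [variationOnFromTo.eq_of_le _ _ h, abs_of_nonneg ENNReal.toReal_nonneg]
    exact le_add_of_nonneg_left ENNReal.toReal_nonneg
  · rw [variationOnFromTo.eq_of_ge _ _ h, abs_neg, abs_of_nonneg ENNReal.toReal_nonneg]
    exact le_add_of_nonneg_right ENNReal.toReal_nonneg

theorem Curve.Rectifiable.arcLength_image {γ : Curve X} (hγ : γ.Rectifiable) :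
    γ.arcLength '' Icc γ.left γ.right = Icc 0 γ.length.toReal := by
  have hm : MonotoneOn γ.arcLength (Icc γ.left γ.right) :=
    variationOnFromTo.monotoneOn hγ.locallyBoundedVariationOn γ.left_mem
  rw [← γ.arcLength_right, ← γ.arcLength_left]
  apply Subset.antisymm
  · rintro _ ⟨t, ht, rfl⟩
    exact ⟨hm γ.left_mem ht ht.1, hm ht γ.right_mem ht.2⟩
  · exact intermediate_value_Icc γ.left_le_right hγ.continuousOn_arcLength

theorem Curve.Rectifiable.unitSpeed_arcLength {γ : Curve X} (hγ : γ.Rectifiable) {t : ℝ}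
    (ht : t ∈ Icc γ.left γ.right) : γ.unitSpeed (γ.arcLength t) = γ.toFun t :=
  edist_eq_zero.1 (edist_naturalParameterization_eq_zero hγ.locallyBoundedVariationOn
    γ.left_mem ht)

/-- Unit speed makes the parametrization 1-Lipschitz. Continuity is what makes indicators of Borel
sets measurable along the curve. -/
theorem Curve.Rectifiable.continuousOn_unitSpeed {γ : Curve X} (hγ : γ.Rectifiable) :
    ContinuousOn γ.unitSpeed (Icc 0 γ.length.toReal) := by
  have h := has_unit_speed_naturalParameterization γ.toFun hγ.locallyBoundedVariationOn γ.left_mem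
  have hi : variationOnFromTo γ.toFun (Icc γ.left γ.right) γ.left '' Icc γ.left γ.right =
    Icc 0 γ.length.toReal := hγ.arcLength_image
  rw [hi] at h
  have key : ∀ x ∈ Icc 0 γ.length.toReal, ∀ y ∈ Icc 0 γ.length.toReal, x ≤ y →
      edist (γ.unitSpeed x) (γ.unitSpeed y) ≤ edist x y := by
    intro x hx y hy hxy
    have := h hx hy
    rw [NNReal.coe_one, one_mul] at this
    rw [edist_comm x, edist_dist y x, Real.dist_eq, abs_of_nonneg (sub_nonneg.2 hxy), ← this]
    exact eVariationOn.edist_le _ ⟨hx, le_rfl, hxy⟩ ⟨hy, hxy, le_rfl⟩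
  have hL : LipschitzOnWith 1 γ.unitSpeed (Icc 0 γ.length.toReal) := by
    intro x hx y hy
    rw [ENNReal.coe_one, one_mul]
    rcases le_total x y with hxy | hxy
    · exact key x hx y hy hxy
    · rw [edist_comm, edist_comm x]
      exact key y hy x hx hxy
  exact hL.continuousOn

theorem Curve.length_pos {γ : Curve X} (hγ : γ.Nonconstant) : 0 < γ.length := by
  obtain ⟨s, hs, t, ht, hst⟩ := hγ
  exact (edist_pos.2 hst).trans_le (eVariationOn.edist_le _ hs ht)

/-- The restriction of a curve to an initial interval. -/
def Curve.initial (γ : Curve X) (t : ℝ) (ht : t ∈ Icc γ.left γ.right) : Curve X where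
  left := γ.left
  right := t
  left_le_right := ht.1
  toFun := γ.toFun
  continuousOn := γ.continuousOn.mono (Icc_subset_Icc_right ht.2)

theorem Curve.length_initial_le (γ : Curve X) {t : ℝ} (ht : t ∈ Icc γ.left γ.right) :
    (γ.initial t ht).length ≤ γ.length :=
  eVariationOn.mono _ (Icc_subset_Icc_right ht.2)

theorem Curve.Rectifiable.initial {γ : Curve X} (hγ : γ.Rectifiable) {t : ℝ}
    (ht : t ∈ Icc γ.left γ.right) : (γ.initial t ht).Rectifiable :=
  ne_top_of_le_ne_top hγ (γ.length_initial_le ht)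

theorem Curve.Rectifiable.unitSpeed_initial {γ : Curve X} (hγ : γ.Rectifiable) {t : ℝ}
    (ht : t ∈ Icc γ.left γ.right) {s : ℝ} (hs : s ∈ Icc 0 (γ.initial t ht).length.toReal) :
    (γ.initial t ht).unitSpeed s = γ.unitSpeed s := by
  rw [← (hγ.initial ht).arcLength_image] at hs
  obtain ⟨r, hr, rfl⟩ := hs
  have hr' : r ∈ Icc γ.left γ.right := Icc_subset_Icc_right ht.2 hr
  rw [(hγ.initial ht).unitSpeed_arcLength hr, Curve.arcLength_eq _ hr]
  change γ.toFun r = γ.unitSpeed (eVariationOn γ.toFun (Icc γ.left r)).toReal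
  rw [← γ.arcLength_eq hr', hγ.unitSpeed_arcLength hr']

theorem Curve.Rectifiable.integral_initial_le {γ : Curve X} (hγ : γ.Rectifiable) {t : ℝ}
    (ht : t ∈ Icc γ.left γ.right) (ρ : X → ℝ≥0∞) :
    (γ.initial t ht).integral ρ ≤ γ.integral ρ := by
  unfold Curve.integral
  rw [setLIntegral_congr_fun (g := fun s => ρ (γ.unitSpeed s)) measurableSet_Icc
    fun s hs => by simp only [hγ.unitSpeed_initial ht hs]]
  exact lintegral_mono_set (Icc_subset_Icc_right
    (ENNReal.toReal_mono hγ (γ.length_initial_le ht)))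

theorem Curve.Rectifiable.integral_const {γ : Curve X} (hγ : γ.Rectifiable) (c : ℝ≥0∞) :
    γ.integral (fun _ => c) = c * γ.length := by
  rw [Curve.integral, setLIntegral_const, Real.volume_Icc, sub_zero, ENNReal.ofReal_toReal hγ]

variable [MeasurableSpace X] [BorelSpace X]

/-- The function `∞ · 1_N` has finite integral only if the curve spends zero time in `N`; this is
how null sets encode negligible families. -/
theorem Curve.Rectifiable.ae_notMem {γ : Curve X} (hγ : γ.Rectifiable) {N : Set X}
    (hN : MeasurableSet N) (h : γ.integral (N.indicator fun _ => ∞) ≠ ∞) :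
    ∀ᵐ s ∂volume.restrict (Icc 0 γ.length.toReal), γ.unitSpeed s ∉ N := by
  have hm : AEMeasurable (fun s => (N.indicator (fun _ => (∞ : ℝ≥0∞))) (γ.unitSpeed s))
      (volume.restrict (Icc 0 γ.length.toReal)) :=
    (measurable_const.indicator hN).comp_aemeasurable
      (hγ.continuousOn_unitSpeed.aemeasurable measurableSet_Icc)
  filter_upwards [ae_lt_top' hm h] with s hs hsN
  simp [hsN] at hs

theorem Curve.Rectifiable.exists_notMem {γ : Curve X} (hγ : γ.Rectifiable) (hc : γ.Nonconstant)
    {N : Set X} (hN : MeasurableSet N) (h : γ.integral (N.indicator fun _ => ∞) ≠ ∞) :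
    ∃ t ∈ Icc γ.left γ.right, γ.toFun t ∉ N := by
  have h1 := hγ.ae_notMem hN h
  rw [ae_restrict_iff' measurableSet_Icc] at h1
  by_contra! hcon
  have h2 : ∀ᵐ s ∂(volume : Measure ℝ), s ∉ Icc 0 γ.length.toReal := by
    filter_upwards [h1] with s hs hs'
    refine hs hs' ?_
    rw [← hγ.arcLength_image] at hs'
    obtain ⟨t, ht, rfl⟩ := hs'
    rw [hγ.unitSpeed_arcLength ht]
    exact hcon t ht
  have h3 : volume (Icc 0 γ.length.toReal) = 0 := measure_eq_zero_iff_ae_notMem.2 h2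
  rw [Real.volume_Icc, sub_zero, ENNReal.ofReal_toReal hγ] at h3
  exact (Curve.length_pos hc).ne' h3

end Curves

/-! ### The energy is a seminorm. -/

section Energy

variable {X : Type*} [MetricSpace X] [MeasurableSpace X]
  {V : Type*} [NormedAddCommGroup V] {μ : Measure X}

theorem sobolevEnergy_le {u : Lp V ∞ μ} {v : X → V} {ρ : X → ℝ≥0∞} (hv : v =ᵐ[μ] u)
    (hρ : IsWeakUpperGradient μ v ρ) : sobolevEnergy u ≤ essSup ρ μ :=
  iInf_le_of_le v (iInf_le_of_le ρ (iInf_le _ ⟨hv, hρ⟩))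

theorem exists_of_sobolevEnergy_lt {u : Lp V ∞ μ} {c : ℝ≥0∞} (h : sobolevEnergy u < c) :
    ∃ (v : X → V) (ρ : X → ℝ≥0∞), v =ᵐ[μ] u ∧ IsWeakUpperGradient μ v ρ ∧ essSup ρ μ < c := by
  simp only [sobolevEnergy, iInf_lt_iff] at h
  obtain ⟨v, ρ, ⟨hv, hρ⟩, h⟩ := h
  exact ⟨v, ρ, hv, hρ, h⟩

theorem sobolevEnergy_add_le (u v : Lp V ∞ μ) :
    sobolevEnergy (u + v) ≤ sobolevEnergy u + sobolevEnergy v := by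
  refine ENNReal.le_of_forall_pos_le_add fun ε hε hfin => ?_
  obtain ⟨hu, hv⟩ := ENNReal.add_lt_top.1 hfin
  have hε2 : (ε / 2 : ℝ≥0∞) ≠ 0 := by simp [hε.ne']
  obtain ⟨v₁, ρ₁, e₁, g₁, b₁⟩ := exists_of_sobolevEnergy_lt (ENNReal.lt_add_right hu.ne hε2)
  obtain ⟨v₂, ρ₂, e₂, g₂, b₂⟩ := exists_of_sobolevEnergy_lt (ENNReal.lt_add_right hv.ne hε2)
  calc sobolevEnergy (u + v) ≤ essSup (ρ₁ + ρ₂) μ :=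
        sobolevEnergy_le ((e₁.add e₂).trans (Lp.coeFn_add u v).symm) (g₁.add g₂)
    _ ≤ essSup ρ₁ μ + essSup ρ₂ μ := ENNReal.essSup_add_le _ _
    _ ≤ (sobolevEnergy u + ε / 2) + (sobolevEnergy v + ε / 2) := add_le_add b₁.le b₂.le
    _ = sobolevEnergy u + sobolevEnergy v + ε := by
        rw [add_add_add_comm, ENNReal.add_halves]

theorem sobolevEnergy_zero : sobolevEnergy (0 : Lp V ∞ μ) = 0 :=
  le_antisymm ((sobolevEnergy_le (Lp.coeFn_zero V ∞ μ).symm (IsWeakUpperGradient.zero μ)).trans_eq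
    (essSup_const_bot (μ := μ) (β := ℝ≥0∞))) bot_le

theorem sobolevNorm_eq_enorm_add (u : Lp V ∞ μ) :
    sobolevNorm u = ‖u‖ₑ + sobolevEnergy u := by
  rw [sobolevNorm, Lp.enorm_def]

variable [NormedSpace ℝ V]

theorem mem_sobolev_iff {u : Lp V ∞ μ} : u ∈ sobolev μ V ↔ sobolevEnergy u < ∞ := by
  constructor
  · rintro ⟨v, ρ, e, g, b⟩
    exact (sobolevEnergy_le e g).trans_lt b
  · intro h
    obtain ⟨v, ρ, e, g, b⟩ := exists_of_sobolevEnergy_lt h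
    exact ⟨v, ρ, e, g, b⟩

theorem sobolevEnergy_smul_le (c : ℝ) (u : Lp V ∞ μ) :
    sobolevEnergy (c • u) ≤ ‖c‖ₑ * sobolevEnergy u := by
  rcases eq_or_ne c 0 with rfl | hc
  · simp [sobolevEnergy_zero]
  have h0 : ‖c‖ₑ ≠ 0 := by simpa using hc
  have hT : ‖c‖ₑ ≠ ∞ := enorm_ne_top
  conv_rhs => rw [sobolevEnergy]
  simp only [ENNReal.mul_iInf_of_ne h0 hT]
  refine le_iInf fun v => le_iInf fun ρ => le_iInf fun h => ?_
  rw [← ENNReal.essSup_const_mul]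
  exact sobolevEnergy_le ((h.1.const_smul c).trans (Lp.coeFn_smul c u).symm) (h.2.smul c)

theorem sobolevNorm_lt_top {u : Lp V ∞ μ} (hu : u ∈ sobolev μ V) : sobolevNorm u < ∞ :=
  ENNReal.add_lt_top.2 ⟨Lp.eLpNorm_lt_top u, mem_sobolev_iff.1 hu⟩

end Energy

/-! ### Upper gradients recast as a constant together with a null set. -/

section Oscillation

variable {X : Type*} [MetricSpace X] {V : Type*} [NormedAddCommGroup V]

/-- `v` oscillates by at most `L * length γ` along every rectifiable curve `γ` spending no time
in `N`. -/
def OscillationLE (v : X → V) (L : ℝ≥0∞) (N : Set X) : Prop :=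
  ∀ γ : Curve X, γ.Rectifiable → γ.integral (N.indicator fun _ => ∞) ≠ ∞ →
    ‖v (γ.toFun γ.left) - v (γ.toFun γ.right)‖ₑ ≤ L * γ.length

theorem OscillationLE.mono {v : X → V} {L : ℝ≥0∞} {N M : Set X} (h : OscillationLE v L N)
    (hNM : N ⊆ M) : OscillationLE v L M := fun γ hγ hM =>
  h γ hγ (ne_top_of_le_ne_top hM (lintegral_mono fun _ =>
    indicator_le_indicator_of_subset hNM (fun _ => bot_le) _))

end Oscillation

/-! ### Countable subadditivity of the energy. -/

section Series

variable {X : Type*} [MetricSpace X] [MeasurableSpace X]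
  {V : Type*} [NormedAddCommGroup V] {μ : Measure X}

/-- The function `∞ · 1_N` witnesses negligibility of the exceptional curves. The bound is asked
only of nonconstant curves, since a constant curve may sit at a point of `N`. -/
theorem OscillationLE.isWeakUpperGradient {v : X → V} {L : ℝ≥0∞} {N : Set X}
    (hN : MeasurableSet N) (hμN : μ N = 0)
    (h : ∀ γ : Curve X, γ.Rectifiable → γ.Nonconstant →
      γ.integral (N.indicator fun _ => ∞) ≠ ∞ →
      ‖v (γ.toFun γ.left) - v (γ.toFun γ.right)‖ₑ ≤ L * γ.length) :
    IsWeakUpperGradient μ v fun _ => L := by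
  refine ⟨measurable_const, N.indicator fun _ => ∞, measurable_const.indicator hN, ?_, ?_⟩
  · refine le_antisymm (essSup_le_of_ae_le _ ?_) bot_le
    filter_upwards [measure_eq_zero_iff_ae_notMem.1 hμN] with x hx
    simp [hx]
  · rintro γ ⟨hc, hγ⟩ hr
    by_contra hcon
    exact hγ ((h γ hr hc hcon).trans_eq (hr.integral_const L).symm)

/-- Take `N = {g ≠ 0} ∪ {ρ > L}`, where `g` witnesses negligibility of the exceptional family. A
curve spending no time in `N` has `∫ g = 0`, hence is not exceptional, and `∫ ρ` is at most `L`
times its length. Unlike exceptional families with their gradients, such null sets are easily united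
over a sequence. -/
theorem IsWeakUpperGradient.exists_oscillationLE [BorelSpace X] {v : X → V} {ρ : X → ℝ≥0∞}
    (h : IsWeakUpperGradient μ v ρ) {L : ℝ≥0∞} (hL : essSup ρ μ ≤ L) :
    ∃ N : Set X, μ N = 0 ∧ OscillationLE v L N := by
  obtain ⟨hρ, g, hg, hg0, hγ⟩ := h
  have hN : μ ({x | g x ≠ 0} ∪ {x | L < ρ x}) = 0 := by
    refine measure_union_null ?_ ?_
    · refine measure_eq_zero_iff_ae_notMem.2 ?_
      filter_upwards [ENNReal.ae_le_essSup (μ := μ) g] with x hx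
      simpa [hg0] using hx
    · refine measure_eq_zero_iff_ae_notMem.2 ?_
      filter_upwards [ENNReal.ae_le_essSup (μ := μ) ρ] with x hx
      simpa using hx.trans hL
  have hm : MeasurableSet ({x | g x ≠ 0} ∪ {x | L < ρ x}) :=
    (hg (measurableSet_singleton 0).compl).union (measurableSet_lt measurable_const hρ)
  refine ⟨_, hN, fun γ hr hfin => ?_⟩
  have hae := hr.ae_notMem hm hfin
  by_cases hc : γ.Nonconstant
  · have hg' : γ.integral g = 0 := by
      rw [Curve.integral, lintegral_congr_ae (g := fun _ => 0), lintegral_zero]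
      filter_upwards [hae] with s hs
      by_contra hne
      exact hs (Or.inl hne)
    have hbad : γ ∉ {γ : Curve X | γ.Nonconstant ∧
        ¬ ‖v (γ.toFun γ.left) - v (γ.toFun γ.right)‖ₑ ≤ γ.integral ρ} := fun hbad => by
      have := hγ γ hbad hr
      simp [hg'] at this
    have hle : ‖v (γ.toFun γ.left) - v (γ.toFun γ.right)‖ₑ ≤ γ.integral ρ := by
      by_contra hcon
      exact hbad ⟨hc, hcon⟩
    refine hle.trans ((lintegral_mono_ae ?_).trans_eq (hr.integral_const L))
    filter_upwards [hae] with s hs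
    by_contra hne
    exact hs (Or.inr (not_le.1 hne))
  · have : γ.toFun γ.left = γ.toFun γ.right := by
      by_contra hne
      exact hc ⟨_, γ.left_mem, _, γ.right_mem, hne⟩
    simp [this]

/-- The pointwise sum of representatives has the sum of the constants `L n` as a weak upper
gradient; choosing `L n` within `δ n` of the energies, with `∑ δ n < ε`, gives the bound. -/
theorem sobolevEnergy_tsum_le [BorelSpace X] [CompleteSpace V] {u : ℕ → Lp V ∞ μ}
    (hu : ∑' n, ‖u n‖ₑ ≠ ∞) (hE : ∑' n, sobolevEnergy (u n) ≠ ∞) :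
    sobolevEnergy (∑' n, u n) ≤ ∑' n, sobolevEnergy (u n) := by
  refine ENNReal.le_of_forall_pos_le_add fun ε hε _ => ?_
  obtain ⟨δ, hδ, hδε⟩ := ENNReal.exists_pos_sum_of_countable (ENNReal.coe_ne_zero.2 hε.ne') ℕ
  have hlt : ∀ n, sobolevEnergy (u n) < sobolevEnergy (u n) + δ n := fun n =>
    ENNReal.lt_add_right (ne_top_of_le_ne_top hE (ENNReal.le_tsum n)) (by simp [(hδ n).ne'])
  choose v ρ hv hρ hL using fun n => exists_of_sobolevEnergy_lt (hlt n)
  choose N₀ hN₀ hosc₀ using fun n => (hρ n).exists_oscillationLE (hL n).le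
  set L : ℕ → ℝ≥0∞ := fun n => sobolevEnergy (u n) + δ n
  have hLsum : ∑' n, L n ≤ ∑' n, sobolevEnergy (u n) + ε := by
    rw [ENNReal.tsum_add]
    gcongr
  have hbd : ∀ᵐ x ∂μ, ∀ n, ‖v n x‖ₑ ≤ ‖u n‖ₑ := by
    refine ae_all_iff.2 fun n => ?_
    filter_upwards [hv n, ae_le_eLpNormEssSup (f := u n) (μ := μ)] with x hx hx'
    rw [hx, Lp.enorm_def, eLpNorm_exponent_top]
    exact hx'
  set N : Set X := toMeasurable μ ((⋃ n, N₀ n) ∪ {x | ¬ ∀ n, ‖v n x‖ₑ ≤ ‖u n‖ₑ})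
  have hsub := subset_toMeasurable μ ((⋃ n, N₀ n) ∪ {x | ¬ ∀ n, ‖v n x‖ₑ ≤ ‖u n‖ₑ})
  have hμN : μ N = 0 := by
    rw [measure_toMeasurable]
    exact measure_union_null (measure_iUnion_null hN₀) hbd
  have hosc : ∀ n, OscillationLE (v n) (L n) N := fun n =>
    (hosc₀ n).mono (((subset_iUnion N₀ n).trans subset_union_left).trans hsub)
  have hN : MeasurableSet N := measurableSet_toMeasurable _ _
  have hWUG : IsWeakUpperGradient μ (fun x => ∑' n, v n x) fun _ => ∑' n, L n := by
    refine OscillationLE.isWeakUpperGradient hN hμN fun γ hr hc hfin => ?_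
    have hLT : ∑' n, L n ≠ ∞ :=
      ne_top_of_le_ne_top (ENNReal.add_ne_top.2 ⟨hE, ENNReal.coe_ne_top⟩) hLsum
    have hdiff : ∑' n, ‖v n (γ.toFun γ.left) - v n (γ.toFun γ.right)‖ₑ ≤ (∑' n, L n) * γ.length := by
      rw [← ENNReal.tsum_mul_right]
      exact ENNReal.tsum_le_tsum fun n => hosc n γ hr hfin
    have hdiffT := ne_top_of_le_ne_top (ENNReal.mul_ne_top hLT hr) hdiff
    -- A divergent `tsum` would be the default value 0 and spoil the inequality, so convergence at
    -- the endpoints is essential. The series converges absolutely at some point of the curve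
    -- outside `N`, and the oscillation bound on the initial subcurve carries this to the left
    -- endpoint.
    have hsl : Summable fun n => v n (γ.toFun γ.left) := by
      obtain ⟨t, ht, htN⟩ := hr.exists_notMem hc hN hfin
      refine Summable.of_enorm (ne_top_of_le_ne_top
        (b := ∑' n, (L n * γ.length + ‖u n‖ₑ)) ?_ (ENNReal.tsum_le_tsum fun n => ?_))
      · rw [ENNReal.tsum_add, ENNReal.tsum_mul_right]
        exact ENNReal.add_ne_top.2 ⟨ENNReal.mul_ne_top hLT hr, hu⟩
      · have h1 := hosc n (γ.initial t ht) (hr.initial ht)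
          (ne_top_of_le_ne_top hfin (hr.integral_initial_le ht _))
        have h2 : ‖v n (γ.toFun t)‖ₑ ≤ ‖u n‖ₑ := by
          by_contra hcon
          exact htN (hsub (Or.inr fun h => hcon (h n)))
        calc ‖v n (γ.toFun γ.left)‖ₑ
            = ‖(v n (γ.toFun γ.left) - v n (γ.toFun t)) + v n (γ.toFun t)‖ₑ := by
              rw [sub_add_cancel]
          _ ≤ ‖v n (γ.toFun γ.left) - v n (γ.toFun t)‖ₑ + ‖v n (γ.toFun t)‖ₑ := enorm_add_le _ _
          _ ≤ L n * γ.length + ‖u n‖ₑ := by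
              refine add_le_add (h1.trans ?_) h2
              gcongr
              exact γ.length_initial_le ht
    have hsr : Summable fun n => v n (γ.toFun γ.right) := by
      have := hsl.sub (Summable.of_enorm hdiffT)
      simpa using this
    rw [← hsl.tsum_sub hsr]
    exact enorm_tsum_le_tsum_enorm.trans hdiff
  have hrep : (fun x => ∑' n, v n x) =ᵐ[μ] (∑' n, u n : Lp V ∞ μ) := by
    filter_upwards [Lp.coeFn_tsum hu, ae_all_iff.2 hv] with x hx hx'
    rw [hx]
    exact tsum_congr hx'
  exact ((sobolevEnergy_le hrep hWUG).trans
    (essSup_le_of_ae_le _ (ae_of_all _ fun _ => le_rfl))).trans hLsum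

end Series

/-! ### The Sobolev space as a Banach space. -/

section Banach

variable {X : Type*} [MetricSpace X] [MeasurableSpace X]

/-- The space `W^{1,∞}(X; V)` as a type carrying its own norm. -/
def SobolevSpace (μ : Measure X) (V : Type*) [NormedAddCommGroup V] [NormedSpace ℝ V] : Type _ :=
  sobolev μ V

variable {μ : Measure X} {V : Type*} [NormedAddCommGroup V] [NormedSpace ℝ V]

/-- Only the linear structure is taken from the submodule; its `L^∞` norm is to be replaced by the
Sobolev norm. -/
instance : AddCommGroup (SobolevSpace μ V) := inferInstanceAs (AddCommGroup (sobolev μ V))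

instance : Module ℝ (SobolevSpace μ V) := inferInstanceAs (Module ℝ (sobolev μ V))

/-- The inclusion of the Sobolev space into `L^∞`. -/
noncomputable def SobolevSpace.incl : SobolevSpace μ V →ₗ[ℝ] Lp V ∞ μ := (sobolev μ V).subtype

theorem SobolevSpace.incl_mem (u : SobolevSpace μ V) : u.incl ∈ sobolev μ V := Subtype.property _

theorem SobolevSpace.incl_injective :
    Function.Injective (SobolevSpace.incl : SobolevSpace μ V → Lp V ∞ μ) :=
  Subtype.val_injective

/-- The Sobolev norm is a norm. -/
noncomputable def SobolevSpace.addGroupNorm (μ : Measure X) (V : Type*) [NormedAddCommGroup V]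
    [NormedSpace ℝ V] : AddGroupNorm (SobolevSpace μ V) where
  toFun u := (sobolevNorm u.incl).toReal
  map_zero' := by simp [sobolevNorm_eq_enorm_add, sobolevEnergy_zero]
  add_le' u v := by
    rw [← ENNReal.toReal_add (sobolevNorm_lt_top u.incl_mem).ne (sobolevNorm_lt_top v.incl_mem).ne]
    refine ENNReal.toReal_mono (ENNReal.add_ne_top.2
      ⟨(sobolevNorm_lt_top u.incl_mem).ne, (sobolevNorm_lt_top v.incl_mem).ne⟩) ?_
    simp only [sobolevNorm_eq_enorm_add, map_add]
    rw [add_add_add_comm]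
    exact add_le_add (enorm_add_le _ _) (sobolevEnergy_add_le _ _)
  neg' u := by
    have key : ∀ w : Lp V ∞ μ, sobolevEnergy (-w) ≤ sobolevEnergy w := fun w => by
      simpa using sobolevEnergy_smul_le (-1 : ℝ) w
    have : sobolevEnergy (-u.incl) = sobolevEnergy u.incl :=
      le_antisymm (key _) (by simpa using key (-u.incl))
    simp [sobolevNorm_eq_enorm_add, this]
  eq_zero_of_map_eq_zero' u hu := by
    rw [ENNReal.toReal_eq_zero_iff, or_iff_left (sobolevNorm_lt_top u.incl_mem).ne,
      sobolevNorm_eq_enorm_add, add_eq_zero, enorm_eq_zero] at hu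
    exact SobolevSpace.incl_injective (hu.1.trans (map_zero _).symm)

noncomputable instance : NormedAddCommGroup (SobolevSpace μ V) :=
  (SobolevSpace.addGroupNorm μ V).toNormedAddCommGroup

theorem SobolevSpace.norm_def (u : SobolevSpace μ V) : ‖u‖ = (sobolevNorm u.incl).toReal := rfl

theorem SobolevSpace.enorm_def (u : SobolevSpace μ V) : ‖u‖ₑ = sobolevNorm u.incl := by
  rw [← ofReal_norm, SobolevSpace.norm_def, ENNReal.ofReal_toReal (sobolevNorm_lt_top u.incl_mem).ne]

noncomputable instance : NormedSpace ℝ (SobolevSpace μ V) where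
  norm_smul_le c u := by
    rw [SobolevSpace.norm_def, SobolevSpace.norm_def, ← toReal_enorm c, ← ENNReal.toReal_mul]
    refine ENNReal.toReal_mono (ENNReal.mul_ne_top enorm_ne_top
      (sobolevNorm_lt_top u.incl_mem).ne) ?_
    simp only [sobolevNorm_eq_enorm_add, map_smul, mul_add, enorm_smul]
    gcongr
    exact sobolevEnergy_smul_le _ _

theorem SobolevSpace.norm_incl_le (u : SobolevSpace μ V) : ‖u.incl‖ ≤ ‖u‖ := by
  rw [← toReal_enorm, ← toReal_enorm, SobolevSpace.enorm_def]
  refine ENNReal.toReal_mono (sobolevNorm_lt_top u.incl_mem).ne ?_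
  rw [sobolevNorm_eq_enorm_add]
  exact le_self_add

/-- An absolutely convergent series is summed in `L^∞`; countable subadditivity, applied to the
tails, shows that the sum is Sobolev and that convergence holds in the Sobolev norm. -/
instance [BorelSpace X] [CompleteSpace V] : CompleteSpace (SobolevSpace μ V) := by
  refine NormedAddCommGroup.completeSpace_of_summable_imp_tendsto fun u hu => ?_
  have hu' : ∑' n, ‖u n‖ₑ ≠ ∞ := by
    rw [tsum_congr fun n => (ofReal_norm (u n)).symm, ← ENNReal.ofReal_tsum_of_nonneg
      (fun n => norm_nonneg _) hu]
    exact ENNReal.ofReal_ne_top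
  have hle1 : ∀ n, ‖(u n).incl‖ₑ ≤ ‖u n‖ₑ := fun n => by
    rw [SobolevSpace.enorm_def, sobolevNorm_eq_enorm_add]; exact le_self_add
  have hle2 : ∀ n, sobolevEnergy (u n).incl ≤ ‖u n‖ₑ := fun n => by
    rw [SobolevSpace.enorm_def, sobolevNorm_eq_enorm_add]; exact le_add_self
  have hT1 : ∀ k, ∑' n, ‖(u (n + k)).incl‖ₑ ≠ ∞ := fun k =>
    ne_top_of_le_ne_top hu' ((ENNReal.tsum_le_tsum fun n => hle1 (n + k)).trans
      (ENNReal.tsum_comp_le_tsum_of_injective (add_left_injective k) _))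
  have hT2 : ∀ k, ∑' n, sobolevEnergy (u (n + k)).incl ≠ ∞ := fun k =>
    ne_top_of_le_ne_top hu' ((ENNReal.tsum_le_tsum fun n => hle2 (n + k)).trans
      (ENNReal.tsum_comp_le_tsum_of_injective (add_left_injective k) _))
  have hmem : ∑' n, (u n).incl ∈ sobolev μ V := by
    rw [mem_sobolev_iff]
    exact (sobolevEnergy_tsum_le (hT1 0) (hT2 0)).trans_lt (hT2 0).lt_top
  let a : SobolevSpace μ V := ⟨∑' n, (u n).incl, hmem⟩
  refine ⟨a, tendsto_iff_edist_tendsto_0.2 ?_⟩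
  have hsum : Summable fun n => (u n).incl := Summable.of_enorm (hT1 0)
  refine tendsto_of_tendsto_of_tendsto_of_le_of_le tendsto_const_nhds
    (ENNReal.tendsto_sum_nat_add (fun n => ‖u n‖ₑ) hu') (fun _ => bot_le) fun k => ?_
  have htail : SobolevSpace.incl (a - ∑ i ∈ Finset.range k, u i) = ∑' n, (u (n + k)).incl := by
    rw [map_sub, map_sum]
    change ∑' n, (u n).incl - _ = _
    rw [← hsum.sum_add_tsum_nat_add k, add_sub_cancel_left]
  rw [edist_comm, edist_eq_enorm_sub, SobolevSpace.enorm_def, htail, sobolevNorm_eq_enorm_add]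
  calc ‖∑' n, (u (n + k)).incl‖ₑ + sobolevEnergy (∑' n, (u (n + k)).incl)
      ≤ ∑' n, ‖(u (n + k)).incl‖ₑ + ∑' n, sobolevEnergy (u (n + k)).incl :=
        add_le_add enorm_tsum_le_tsum_enorm (sobolevEnergy_tsum_le (hT1 k) (hT2 k))
    _ = ∑' n, ‖u (n + k)‖ₑ := by
        rw [← ENNReal.tsum_add]
        exact tsum_congr fun n => by rw [SobolevSpace.enorm_def, sobolevNorm_eq_enorm_add]

end Banach

/-! ### Uniform Lipschitz bounds for Sobolev classes. -/

section Representatives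

variable {X : Type*} [MetricSpace X] [MeasurableSpace X]
  {μ : Measure X} {V : Type*} [NormedAddCommGroup V]

/-- If `f x ∉ C`, then `f` avoids `C` on the part of the support near `x`, although every
neighbourhood of `x` has positive measure. This makes continuous representatives unique on the
support. -/
theorem mem_of_ae_mem_of_continuousOn_support [SecondCountableTopology X] {Y : Type*} [TopologicalSpace Y] {f : X → Y}
    {C : Set Y} (hf : ContinuousOn f μ.support) (hC : IsClosed C) (h : ∀ᵐ x ∂μ, f x ∈ C)
    {x : X} (hx : x ∈ μ.support) : f x ∈ C := by
  by_contra hcon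
  obtain ⟨U, hU, hUS⟩ := mem_nhdsWithin_iff_exists_mem_nhds_inter.1
    (hf x hx (hC.isOpen_compl.mem_nhds hcon))
  have hpos := (Measure.mem_support_iff_forall x).1 hx U hU
  refine hpos.ne' (measure_eq_zero_iff_ae_notMem.2 ?_)
  filter_upwards [h, Measure.support_mem_ae (μ := μ)] with z hz hzS hzU
  exact hUS ⟨hzU, hzS⟩ hz

theorem eqOn_support_of_ae_eq [SecondCountableTopology X] {f g : X → V} (hf : ContinuousOn f μ.support)
    (hg : ContinuousOn g μ.support) (h : f =ᵐ[μ] g) : EqOn f g μ.support := fun x hx => by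
  have := mem_of_ae_mem_of_continuousOn_support (hf.sub hg) (isClosed_singleton (x := (0 : V)))
    (h.mono fun z hz => by simp [hz]) hx
  simpa [sub_eq_zero] using this

theorem ae_norm_le_norm {α : Type*} [MeasurableSpace α] {μ : Measure α} (u : Lp V ∞ μ) : ∀ᵐ x ∂μ, ‖u x‖ ≤ ‖u‖ := by
  filter_upwards [ae_le_eLpNormEssSup (f := u) (μ := μ)] with x hx
  rw [← eLpNorm_exponent_top, ← Lp.enorm_def] at hx
  exact enorm_le_iff_norm_le.1 hx

theorem norm_le_of_ae_eq_Lp [SecondCountableTopology X] {f : X → V} (hf : ContinuousOn f μ.support) {u : Lp V ∞ μ}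
    (h : f =ᵐ[μ] u) {x : X} (hx : x ∈ μ.support) : ‖f x‖ ≤ ‖u‖ := by
  have := mem_of_ae_mem_of_continuousOn_support hf (Metric.isClosed_closedBall (x := 0) (ε := ‖u‖))
    (by filter_upwards [h, ae_norm_le_norm u] with z hz hz'; simpa [hz] using hz') hx
  simpa using this

/-- `LIP^∞ = W^{1,∞}` for real functions implies a quantitative Lipschitz bound, by the
Banach–Steinhaus theorem. -/
theorem LipEqSobolev.exists_bound_real [SecondCountableTopology X] [BorelSpace X] (heq : LipEqSobolev μ) :
    ∃ C : ℝ≥0, ∀ u ∈ sobolev μ ℝ, ∃ N : Set X, μ N = 0 ∧ ∀ x ∉ N, ∀ y ∉ N,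
      ‖u x - u y‖ ≤ C * (sobolevNorm u).toReal * dist x y := by
  have hex : ∀ w : SobolevSpace μ ℝ, ∃ f : X → ℝ, (∃ K : ℝ≥0, LipschitzWith K f) ∧
      f =ᵐ[μ] w.incl := fun w => by
    obtain ⟨f, hf, hfw⟩ := (heq w.incl).1 w.incl_mem
    exact ⟨f, hf.1, hfw⟩
  choose f hlip hf using hex
  have hcont : ∀ w, ContinuousOn (f w) μ.support := fun w =>
    (hlip w).choose_spec.continuous.continuousOn
  have hadd : ∀ w₁ w₂, EqOn (f (w₁ + w₂)) (f w₁ + f w₂) μ.support := fun w₁ w₂ => by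
    refine eqOn_support_of_ae_eq (hcont _) ((hcont _).add (hcont _)) ((hf _).trans ?_)
    rw [map_add]
    exact (Lp.coeFn_add _ _).trans ((hf w₁).add (hf w₂)).symm
  have hsmul : ∀ (c : ℝ) w, EqOn (f (c • w)) (c • f w) μ.support := fun c w => by
    refine eqOn_support_of_ae_eq (hcont _) ((hcont _).const_smul c) ((hf _).trans ?_)
    rw [map_smul]
    exact (Lp.coeFn_smul _ _).trans ((hf w).const_smul c).symm
  have hnorm : ∀ w, ∀ x ∈ μ.support, ‖f w x‖ ≤ ‖w‖ := fun w x hx =>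
    (norm_le_of_ae_eq_Lp (hcont w) (hf w) hx).trans w.norm_incl_le
  -- Representatives depend linearly on the class only on the support, hence the restriction on the
  -- pairs. On the diagonal the inverse distance is 0 and the functional vanishes.
  let g : {p : X × X // p.1 ∈ μ.support ∧ p.2 ∈ μ.support} → SobolevSpace μ ℝ →L[ℝ] ℝ := fun p =>
    LinearMap.mkContinuous
      { toFun := fun w => (dist p.1.1 p.1.2)⁻¹ * (f w p.1.1 - f w p.1.2)
        map_add' := fun w₁ w₂ => by
          rw [hadd w₁ w₂ p.2.1, hadd w₁ w₂ p.2.2]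
          simp only [Pi.add_apply]
          ring
        map_smul' := fun c w => by
          rw [hsmul c w p.2.1, hsmul c w p.2.2]
          simp only [Pi.smul_apply, smul_eq_mul, RingHom.id_apply]
          ring }
      ((dist p.1.1 p.1.2)⁻¹ * 2) fun w => by
        simp only [LinearMap.coe_mk, AddHom.coe_mk, norm_mul, norm_inv, Real.norm_eq_abs,
          abs_dist]
        rw [mul_assoc]
        refine mul_le_mul_of_nonneg_left ?_ (inv_nonneg.2 dist_nonneg)
        have h1 := hnorm w _ p.2.1
        have h2 := hnorm w _ p.2.2
        have h3 := norm_sub_le (f w p.1.1) (f w p.1.2)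
        rw [Real.norm_eq_abs] at h3
        linarith
  have hg : ∀ p w, g p w = (dist p.1.1 p.1.2)⁻¹ * (f w p.1.1 - f w p.1.2) := fun p w => rfl
  obtain ⟨C, hC⟩ := banach_steinhaus (g := g) fun w => by
    obtain ⟨K, hK⟩ := hlip w
    refine ⟨K, fun p => ?_⟩
    rw [hg, norm_mul, norm_inv, Real.norm_eq_abs, abs_dist]
    refine inv_mul_le_of_le_mul₀ dist_nonneg K.coe_nonneg ?_
    rw [← dist_eq_norm, mul_comm]
    exact hK.dist_le_mul _ _
  refine ⟨C.toNNReal, fun u hu => ?_⟩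
  let w : SobolevSpace μ ℝ := ⟨u, hu⟩
  refine ⟨μ.supportᶜ ∪ {x | ¬ f w x = u x},
    measure_union_null Measure.measure_compl_support (hf w), fun x hx y hy => ?_⟩
  simp only [mem_union, mem_compl_iff, mem_ofPred_eq, not_or, not_not] at hx hy
  rw [← hx.2, ← hy.2]
  rcases eq_or_ne x y with rfl | hxy
  · simp
  have h1 := ((g ⟨(x, y), hx.1, hy.1⟩).le_opNorm w).trans
    (mul_le_mul_of_nonneg_right ((hC _).trans (Real.le_coe_toNNReal C)) (norm_nonneg w))
  rw [hg, norm_mul, norm_inv, Real.norm_eq_abs, abs_dist,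
    inv_mul_le_iff₀ (dist_pos.2 hxy), mul_comm] at h1
  exact h1

/-- A functional of norm at most one does not increase differences, so every weak upper gradient of
`v` is one of `φ ∘ v`. -/
theorem sobolevEnergy_compLp_le [NormedSpace ℝ V] (φ : V →L[ℝ] ℝ) (hφ : ‖φ‖ ≤ 1) (u : Lp V ∞ μ) :
    sobolevEnergy (φ.compLp u) ≤ sobolevEnergy u := by
  refine le_iInf fun v => le_iInf fun ρ => le_iInf fun h => ?_
  refine sobolevEnergy_le (v := φ ∘ v) ?_ ⟨h.2.1, h.2.2.mono ?_⟩
  · filter_upwards [h.1, φ.coeFn_compLp u] with x hx hx'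
    rw [hx', Function.comp_apply, hx]
  · rintro γ ⟨hc, hγ⟩
    refine ⟨hc, fun hle => hγ (le_trans ?_ hle)⟩
    rw [Function.comp_apply, Function.comp_apply, ← map_sub, enorm_le_iff_norm_le]
    exact (φ.le_opNorm _).trans (mul_le_of_le_one_left (norm_nonneg _) hφ)

theorem sobolevNorm_compLp_le [NormedSpace ℝ V] (φ : V →L[ℝ] ℝ) (hφ : ‖φ‖ ≤ 1) (u : Lp V ∞ μ) :
    sobolevNorm (φ.compLp u) ≤ sobolevNorm u := by
  rw [sobolevNorm_eq_enorm_add, sobolevNorm_eq_enorm_add]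
  refine add_le_add (enorm_le_iff_norm_le.2 ?_) (sobolevEnergy_compLp_le φ hφ u)
  exact (φ.norm_compLp_le u).trans (mul_le_of_le_one_left (norm_nonneg _) hφ)

/-- Norming functionals of a countable set whose closure contains `R` suffice, by approximation. -/
theorem exists_countable_norming [NormedSpace ℝ V] {R : Set V}
    (hR : TopologicalSpace.IsSeparable R) :
    ∃ Φ : Set (V →L[ℝ] ℝ), Φ.Countable ∧ (∀ φ ∈ Φ, ‖φ‖ ≤ 1) ∧
      ∀ w ∈ R, ∀ M : ℝ, (∀ φ ∈ Φ, ‖φ w‖ ≤ M) → ‖w‖ ≤ M := by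
  obtain ⟨c, hc, hRc⟩ := hR
  choose φ hφ1 hφ2 using fun e : V => exists_dual_vector'' ℝ e
  refine ⟨φ '' c, hc.image φ, ?_, fun w hw M hM => ?_⟩
  · rintro _ ⟨e, -, rfl⟩
    exact hφ1 e
  · refine le_of_forall_pos_le_add fun ε hε => ?_
    obtain ⟨e, hec, hew⟩ := Metric.mem_closure_iff.1 (hRc hw) (ε / 2) (half_pos hε)
    rw [dist_eq_norm] at hew
    have h1 : ‖e‖ ≤ ‖φ e w‖ + ‖φ e (w - e)‖ := by
      have h2 := norm_sub_le (φ e w) (φ e (w - e))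
      rw [← map_sub, sub_sub_cancel, hφ2 e] at h2
      simpa using h2
    have h3 := (φ e).le_of_opNorm_le (hφ1 e) (w - e)
    have h4 := hM (φ e) (mem_image_of_mem φ hec)
    have h5 := norm_sub_norm_le w e
    linarith

theorem LipEqSobolev.exists_bound [SecondCountableTopology X] [BorelSpace X] (heq : LipEqSobolev μ) :
    ∃ C : ℝ≥0, ∀ {V : Type*} [NormedAddCommGroup V] [NormedSpace ℝ V], ∀ u ∈ sobolev μ V,
      ∃ N : Set X, μ N = 0 ∧ ∀ x ∉ N, ∀ y ∉ N,
        ‖u x - u y‖ ≤ C * (sobolevNorm u).toReal * dist x y := by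
  obtain ⟨C, hC⟩ := heq.exists_bound_real
  refine ⟨C, fun {V} _ _ u hu => ?_⟩
  -- The vectors to be normed are the differences `u x - u y`; countability of the norming family
  -- keeps the union of the exceptional sets null.
  have hR : TopologicalSpace.IsSeparable
      ((fun p : V × V => p.1 - p.2) '' (range u ×ˢ range u)) :=
    ((Lp.stronglyMeasurable u).isSeparable_range.prod
      (Lp.stronglyMeasurable u).isSeparable_range).image continuous_sub
  obtain ⟨Φ, hΦc, hΦ1, hΦ⟩ := exists_countable_norming hR
  have hmem : ∀ φ ∈ Φ, φ.compLp u ∈ sobolev μ ℝ := fun φ hφ =>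
    mem_sobolev_iff.2 ((sobolevEnergy_compLp_le φ (hΦ1 φ hφ) u).trans_lt (mem_sobolev_iff.1 hu))
  have hN : ∀ φ ∈ Φ, ∃ N : Set X, μ N = 0 ∧ ∀ x ∉ N, ∀ y ∉ N,
      ‖φ (u x - u y)‖ ≤ C * (sobolevNorm u).toReal * dist x y := fun φ hφ => by
    obtain ⟨N, hN, h⟩ := hC _ (hmem φ hφ)
    refine ⟨N ∪ {x | ¬ φ.compLp u x = φ (u x)}, measure_union_null hN (φ.coeFn_compLp u),
      fun x hx y hy => ?_⟩
    simp only [mem_union, mem_ofPred_eq, not_or, not_not] at hx hy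
    rw [map_sub, ← hx.2, ← hy.2]
    refine (h x hx.1 y hy.1).trans ?_
    gcongr
    · exact (sobolevNorm_lt_top hu).ne
    · exact sobolevNorm_compLp_le φ (hΦ1 φ hφ) u
  choose! N hN0 hNb using hN
  refine ⟨⋃ φ ∈ Φ, N φ, (measure_biUnion_null_iff hΦc).2 hN0, fun x hx y hy => ?_⟩
  simp only [mem_iUnion, not_exists] at hx hy
  exact hΦ _ ⟨(u x, u y), ⟨mem_range_self x, mem_range_self y⟩, rfl⟩ _
    fun φ hφ => hNb φ hφ x (hx φ hφ) y (hy φ hφ)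

end Representatives

/-! ### From full measure to the support. -/

section Extension

theorem exists_lipschitzOnWith_closure {X V : Type*} [PseudoMetricSpace X] [MetricSpace V]
    [CompleteSpace V] {f : X → V} {D : Set X} {K : ℝ≥0} (hf : LipschitzOnWith K f D) :
    ∃ g : X → V, LipschitzOnWith K g (closure D) ∧ EqOn g f D := by
  have hex : ∀ x : X, ∃ y : V, x ∈ closure D → Tendsto f (𝓝[D] x) (𝓝 y) := fun x => by
    by_cases hx : x ∈ closure D
    · have : (𝓝[D] x).NeBot := mem_closure_iff_nhdsWithin_neBot.1 hx
      have hc : Cauchy (map f (𝓝[D] x)) := by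
        refine ⟨inferInstance, ?_⟩
        have h1 := hf.uniformContinuousOn
        rw [UniformContinuousOn] at h1
        rw [prod_map_map_eq]
        refine h1.mono_left (le_inf ?_ ?_)
        · rw [← nhdsWithin_prod_eq]
          exact nhdsWithin_le_nhds.trans (nhds_prod_eq.trans_le (cauchy_nhds).2)
        · rw [← nhdsWithin_prod_eq]
          exact le_principal_iff.2 self_mem_nhdsWithin
      obtain ⟨y, hy⟩ := CompleteSpace.complete hc
      exact ⟨y, fun _ => hy⟩
    · exact ⟨f x, fun h => absurd h hx⟩
  choose g hg using hex
  refine ⟨g, fun x hx y hy => ?_, fun x hx => ?_⟩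
  · have : (𝓝[D] x).NeBot := mem_closure_iff_nhdsWithin_neBot.1 hx
    have : (𝓝[D] y).NeBot := mem_closure_iff_nhdsWithin_neBot.1 hy
    have h1 : Tendsto (fun p : X × X => edist (f p.1) (f p.2)) (𝓝[D] x ×ˢ 𝓝[D] y)
        (𝓝 (edist (g x) (g y))) :=
      ((hg x hx).comp tendsto_fst).edist ((hg y hy).comp tendsto_snd)
    have h2 : Tendsto (fun p : X × X => K * edist p.1 p.2) (𝓝[D] x ×ˢ 𝓝[D] y)
        (𝓝 (K * edist x y)) := by
      refine ENNReal.Tendsto.const_mul ?_ (Or.inr ENNReal.coe_ne_top)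
      exact ((tendsto_nhdsWithin_of_tendsto_nhds tendsto_id).comp tendsto_fst).edist
        ((tendsto_nhdsWithin_of_tendsto_nhds tendsto_id).comp tendsto_snd)
    refine le_of_tendsto_of_tendsto h1 h2 ?_
    filter_upwards [prod_mem_prod (self_mem_nhdsWithin (s := D)) (self_mem_nhdsWithin (s := D))]
      with p hp
    exact hf hp.1 hp.2
  · have : (𝓝[D] x).NeBot := mem_closure_iff_nhdsWithin_neBot.1 (subset_closure hx)
    exact tendsto_nhds_unique (hg x (subset_closure hx)) (hf.continuousOn x hx)

/-- The complement of a null set is dense in the support, so the Lipschitz bound passes to the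
closure. -/
theorem LipEqSobolev.exists_lipschitz_representative {X : Type*} [MetricSpace X]
    [SecondCountableTopology X] [MeasurableSpace X] [BorelSpace X] {μ : Measure X}
    (heq : LipEqSobolev μ) :
    ∃ C : ℝ≥0, ∀ {V : Type*} [NormedAddCommGroup V] [NormedSpace ℝ V] [CompleteSpace V],
      ∀ u ∈ sobolev μ V, ∃ f : X → V,
        LipschitzOnWith (C * (sobolevNorm u).toNNReal) f μ.support ∧ f =ᵐ[μ] u := by
  obtain ⟨C, hC⟩ := heq.exists_bound
  refine ⟨C, fun {V} _ _ _ u hu => ?_⟩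
  obtain ⟨N, hN, h⟩ := hC u hu
  have hlip : LipschitzOnWith (C * (sobolevNorm u).toNNReal) u Nᶜ :=
    LipschitzOnWith.of_dist_le_mul fun x hx y hy => by
      rw [dist_eq_norm]
      exact h x hx y hy
  obtain ⟨g, hg, hgu⟩ := exists_lipschitzOnWith_closure hlip
  refine ⟨g, hg.mono ?_, ?_⟩
  · exact Measure.support_subset_of_isClosed isClosed_closure
      (mem_of_superset (compl_mem_ae_iff.2 hN) subset_closure)
  · filter_upwards [compl_mem_ae_iff.2 hN] with x hx
    exact hgu hx

end Extension

/-! ### Whitney coverings and partitions of unity from Nagata dimension. -/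

section Whitney

variable {Z : Type*} [MetricSpace Z]

theorem exists_nagataDimLE {X : Type*} [MetricSpace X] (h : nagataDim X < ⊤) :
    ∃ n, NagataDimLE X n := by
  obtain ⟨_, ⟨n, -, hn⟩, -⟩ := sInf_lt_iff.1 h
  exact ⟨n, hn⟩

theorem NagataDimLE.exists_cover {T : Set Z} {n : ℕ} (h : NagataDimLE T n) :
    ∃ c : ℝ, 0 < c ∧ ∀ s : ℝ, 0 < s → ∃ 𝒟 : Set (Set Z),
      (∀ x ∈ T, ∃ D ∈ 𝒟, x ∈ D) ∧ (∀ D ∈ 𝒟, ∀ x ∈ D, ∀ y ∈ D, dist x y ≤ c * s) ∧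
      ∀ A ⊆ T, (∀ x ∈ A, ∀ y ∈ A, dist x y ≤ s) →
        {D ∈ 𝒟 | (A ∩ D).Nonempty}.encard ≤ (n : ℕ∞) + 1 := by
  obtain ⟨c, hc, h⟩ := h
  refine ⟨c, hc, fun s hs => ?_⟩
  obtain ⟨𝒟, hcov, hdiam, hmult⟩ := h s hs
  refine ⟨image Subtype.val '' 𝒟, fun x hx => ?_, ?_, fun A hA hAs => ?_⟩
  · obtain ⟨D, hD, hxD⟩ := (hcov ▸ mem_univ (⟨x, hx⟩ : T) : _ ∈ ⋃₀ 𝒟)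
    exact ⟨_, mem_image_of_mem _ hD, mem_image_of_mem _ hxD⟩
  · rintro _ ⟨D, hD, rfl⟩ _ ⟨x, hx, rfl⟩ _ ⟨y, hy, rfl⟩
    have h1 := (Metric.edist_le_ediam_of_mem hx hy).trans (hdiam D hD)
    rw [edist_dist] at h1
    exact (ENNReal.ofReal_le_ofReal_iff (by positivity)).1 h1
  · have h1 := hmult (Subtype.val ⁻¹' A) (Metric.ediam_le fun x hx y hy => by
      rw [edist_dist]
      exact ENNReal.ofReal_le_ofReal (hAs _ hx _ hy))
    refine le_trans (encard_le_encard ?_) ((encard_image_le (image Subtype.val) _).trans h1)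
    rintro _ ⟨⟨D, hD, rfl⟩, _, hxA, y, hy, rfl⟩
    exact ⟨D, ⟨hD, y, hxA, hy⟩, rfl⟩

/-- A Whitney type covering of the complement of `S`, obtained from a set `T` of finite Nagata
dimension that is close to every point outside of `S`. -/
theorem exists_whitney_cover {S T : Set Z} (hS : IsClosed S) (hne : S.Nonempty) {n : ℕ}
    (hT : NagataDimLE T n) (hq : ∀ x ∉ S, ∃ t ∈ T, dist x t ≤ 2 * Metric.infDist x S) :
    ∃ (D : ℤ × Set Z → Set Z) (A : ℝ), 0 ≤ A ∧ (∀ x ∉ S, ∃ i, x ∈ D i) ∧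
      (∀ i, (D i).Nonempty → ∃ p ∈ S, ∀ x ∈ D i, dist x p ≤ A * Metric.infDist x S) ∧
      ∀ x ∉ S, {i | ∃ y ∈ D i, dist x y < Metric.infDist x S / 2}.encard ≤
        ((3 * (n + 1) : ℕ) : ℕ∞) := by
  obtain ⟨c, hc, hcov⟩ := hT.exists_cover
  -- The scale 12 · 2^k bounds `dist (q y) (q z)` for points `y`, `z` of layer `k` near a common
  -- `x`: each of `dist y (q y)`, `dist y z` and `dist z (q z)` is at most 4 · 2^k.
  have hs : ∀ k : ℤ, (0 : ℝ) < 12 * 2 ^ k := fun k => by positivity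
  choose 𝒟 h𝒟 hdiam hmult using fun k : ℤ => hcov _ (hs k)
  choose! q hqT hqd using hq
  have hpos : ∀ x ∉ S, 0 < Metric.infDist x S := fun x hx =>
    (hS.notMem_iff_infDist_pos hne).1 hx
  have hlo : ∀ x ∉ S, (2 : ℝ) ^ Int.log 2 (Metric.infDist x S) ≤ Metric.infDist x S :=
    fun x hx => by simpa using Int.zpow_log_le_self (b := 2) (R := ℝ) one_lt_two (hpos x hx)
  have hhi : ∀ x, Metric.infDist x S < 2 * (2 : ℝ) ^ Int.log 2 (Metric.infDist x S) := fun x => by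
    have := Int.lt_zpow_succ_log_self (b := 2) (R := ℝ) one_lt_two (Metric.infDist x S)
    rw [zpow_add_one₀ (by simp)] at this
    simpa [mul_comm] using this
  -- A piece consists of the points of one dyadic layer around `S` that `q` sends into one set of
  -- the Nagata covering at that scale.
  refine ⟨fun i => {x | x ∉ S ∧ Int.log 2 (Metric.infDist x S) = i.1 ∧ i.2 ∈ 𝒟 i.1 ∧ q x ∈ i.2},
    12 * c + 12, by positivity, fun x hx => ?_, ?_, fun x hx => ?_⟩
  · obtain ⟨E, hE, hxE⟩ := h𝒟 (Int.log 2 (Metric.infDist x S)) _ (hqT x hx)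
    exact ⟨(_, E), hx, rfl, hE, hxE⟩
  · rintro ⟨k, E⟩ ⟨y, hyS, hyk, hE, hyE⟩
    dsimp only at hyk hE hyE
    obtain ⟨p, hp, hyp⟩ := (Metric.infDist_lt_iff hne).1
      (lt_mul_of_one_lt_left (hpos y hyS) one_lt_two)
    refine ⟨p, hp, ?_⟩
    rintro x ⟨hxS, hxk, -, hxE⟩
    dsimp only at hxk hxE
    have h1 := hdiam k E hE _ hxE _ hyE
    have h2 := hqd x hxS
    have h3 := hqd y hyS
    have h4 := hhi x
    have h5 := hhi y
    have h6 := hlo x hxS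
    rw [hxk] at h4 h6
    rw [hyk] at h5
    have h7 : dist x p ≤ dist x (q x) + dist (q x) (q y) + dist y (q y) + dist y p := by
      have h8 := dist_triangle4 x (q x) (q y) p
      have h9 := dist_triangle_left (q y) p y
      linarith
    have h10 : (12 * c + 12) * (2 : ℝ) ^ k ≤ (12 * c + 12) * Metric.infDist x S := by gcongr
    linarith
  · set r := Metric.infDist x S
    have hr := hpos x hx
    have hnear : ∀ y, dist x y < r / 2 →
        r / 2 < Metric.infDist y S ∧ Metric.infDist y S < 3 / 2 * r := fun y hy => by
      have h1 : r ≤ Metric.infDist y S + dist x y := Metric.infDist_le_infDist_add_dist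
      have h2 : Metric.infDist y S ≤ r + dist y x := Metric.infDist_le_infDist_add_dist
      rw [dist_comm y x] at h2
      constructor <;> linarith
    obtain ⟨k₀, hk₀⟩ : ∃ k₀, Int.log 2 (Metric.infDist x S) = k₀ := ⟨_, rfl⟩
    let A : ℤ → Set Z := fun k =>
      q '' {y | y ∉ S ∧ dist x y < r / 2 ∧ Int.log 2 (Metric.infDist y S) = k}
    have hA : ∀ k, {E ∈ 𝒟 k | (A k ∩ E).Nonempty}.encard ≤ (n : ℕ∞) + 1 := fun k => by
      refine hmult k (A k) ?_ ?_
      · rintro _ ⟨y, hy, rfl⟩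
        exact hqT y hy.1
      · rintro _ ⟨y, ⟨hy, hxy, hyk⟩, rfl⟩ _ ⟨z, ⟨hz, hxz, hzk⟩, rfl⟩
        have h1 := hqd y hy
        have h2 := hqd z hz
        have h3 := hhi y
        have h4 := hhi z
        have h5 := (hnear y hxy).1
        rw [hyk] at h3
        rw [hzk] at h4
        have h6 := dist_triangle4 (q y) y z (q z)
        have h7 := dist_triangle_left y z x
        rw [dist_comm (q y) y] at h6
        linarith
    let I : ℤ → Set (ℤ × Set Z) := fun k => Prod.mk k '' {E ∈ 𝒟 k | (A k ∩ E).Nonempty}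
    have hI : ∀ k, (I k).encard ≤ (n : ℕ∞) + 1 := fun k => (encard_image_le _ _).trans (hA k)
    -- Distances to `S` near `x` lie between `r / 2` and `3 r / 2`, so only three layers occur, each
    -- contributing at most `n + 1` pieces.
    refine (encard_le_encard (t := I (k₀ - 1) ∪ I k₀ ∪ I (k₀ + 1)) ?_).trans ?_
    · rintro ⟨k, E⟩ ⟨y, ⟨hyS, hyk, hE, hyE⟩, hxy⟩
      dsimp only at hyk hE hyE
      have hmem : (k, E) ∈ I k :=
        mem_image_of_mem _ ⟨hE, q y, mem_image_of_mem q ⟨hyS, hxy, hyk⟩, hyE⟩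
      have hk1 : k₀ - 1 ≤ k := by
        have h1 := (hlo x hx).trans_lt ((by linarith [(hnear y hxy).1] :
          r < 2 * Metric.infDist y S).trans (mul_lt_mul_of_pos_left (hhi y) two_pos))
        rw [hyk, hk₀, ← mul_assoc, mul_comm, show (2 * 2 : ℝ) = 2 ^ (2 : ℤ) by norm_num,
          ← zpow_add₀ two_ne_zero] at h1
        have := (zpow_lt_zpow_iff_right₀ (one_lt_two (α := ℝ))).1 h1
        omega
      have hk2 : k ≤ k₀ + 1 := by
        have h1 := (hlo y hyS).trans_lt ((hnear y hxy).2.trans ((by linarith :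
          3 / 2 * r < 2 * r).trans (mul_lt_mul_of_pos_left (hhi x) two_pos)))
        rw [hyk, hk₀, ← mul_assoc, mul_comm, show (2 * 2 : ℝ) = 2 ^ (2 : ℤ) by norm_num,
          ← zpow_add₀ two_ne_zero] at h1
        have := (zpow_lt_zpow_iff_right₀ (one_lt_two (α := ℝ))).1 h1
        omega
      obtain rfl | rfl | rfl : k = k₀ - 1 ∨ k = k₀ ∨ k = k₀ + 1 := by omega
      · exact Or.inl (Or.inl hmem)
      · exact Or.inl (Or.inr hmem)
      · exact Or.inr hmem
    · calc (I (k₀ - 1) ∪ I k₀ ∪ I (k₀ + 1)).encard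
          ≤ (I (k₀ - 1)).encard + (I k₀).encard + (I (k₀ + 1)).encard :=
            (encard_union_le _ _).trans (add_le_add_left (encard_union_le _ _) _)
        _ ≤ ((n : ℕ∞) + 1) + (n + 1) + (n + 1) := add_le_add (add_le_add (hI _) (hI _)) (hI _)
        _ = ((3 * (n + 1) : ℕ) : ℕ∞) := by push_cast; ring

/-- A partition of unity on the complement of `S`, indexed by points `p i` of `S`. -/
structure WhitneyPartition (S : Set Z) (ι : Type*) where
  weight : ι → Z → ℝ
  point : ι → Z
  card : ℕ
  B : ℝ≥0
  M : ℝ≥0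
  point_mem : ∀ i, point i ∈ S
  weight_nonneg : ∀ i x, 0 ≤ weight i x
  finsum_weight : ∀ x ∉ S, ∑ᶠ i, weight i x = 1
  encard_support_le : ∀ x ∉ S, (Function.support fun i => weight i x).encard ≤ card
  dist_point_le : ∀ x ∉ S, ∀ i, weight i x ≠ 0 → dist x (point i) ≤ B * Metric.infDist x S
  abs_sub_le : ∀ x ∉ S, ∀ y ∉ S, ∀ i,
    |weight i x - weight i y| * Metric.infDist x S ≤ M * dist x y

/-- The bumps `max (infDist x S / 2 - infDist x (D i)) 0` are normalized by their sum. Empty pieces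
are dropped because `infDist` to the empty set is 0. -/
theorem exists_whitneyPartition.{u} {Z : Type u} [MetricSpace Z] {S T : Set Z} (hS : IsClosed S) (hne : S.Nonempty) {n : ℕ}
    (hT : NagataDimLE T n) (hq : ∀ x ∉ S, ∃ t ∈ T, dist x t ≤ 2 * Metric.infDist x S) :
    ∃ ι : Type u, Nonempty (WhitneyPartition S ι) := by
  obtain ⟨D, A, hA0, hcov, hp, hmult⟩ := exists_whitney_cover hS hne hT hq
  let ι := {i // (D i).Nonempty}
  choose p hpS hpd using fun i : ι => hp i.1 i.2
  have hpos : ∀ x ∉ S, 0 < Metric.infDist x S := fun x hx =>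
    (hS.notMem_iff_infDist_pos hne).1 hx
  let N : ℕ := 3 * (n + 1)
  let σ : ι → Z → ℝ := fun i x => max (Metric.infDist x S / 2 - Metric.infDist x (D i)) 0
  have hσ0 : ∀ i x, 0 ≤ σ i x := fun i x => le_max_right _ _
  have hσne : ∀ i x, σ i x ≠ 0 → ∃ y ∈ D i, dist x y < Metric.infDist x S / 2 := by
    intro i x h
    refine (Metric.infDist_lt_iff i.2).1 ?_
    by_contra hcon
    exact h (max_eq_right (by linarith))
  have hcard : ∀ x ∉ S, (Function.support fun i => σ i x).encard ≤ N := fun x hx => by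
    rw [← Subtype.val_injective.encard_image]
    refine (encard_le_encard ?_).trans (hmult x hx)
    rintro _ ⟨i, hi, rfl⟩
    exact hσne i x hi
  have hfin : ∀ x ∉ S, (Function.support fun i => σ i x).Finite := fun x hx =>
    finite_of_encard_le_coe (hcard x hx)
  have hσlip : ∀ i x y, |σ i x - σ i y| ≤ 2 * dist x y := fun i x y => by
    have h1 := Metric.infDist_le_infDist_add_dist (s := S) (x := x) (y := y)
    have h2 := Metric.infDist_le_infDist_add_dist (s := S) (x := y) (y := x)
    have h3 := Metric.infDist_le_infDist_add_dist (s := D i) (x := x) (y := y)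
    have h4 := Metric.infDist_le_infDist_add_dist (s := D i) (x := y) (y := x)
    rw [dist_comm y x] at h2 h4
    have h5 : 0 ≤ dist x y := dist_nonneg
    refine (abs_max_sub_max_le_abs _ _ _).trans ?_
    rw [abs_le]
    constructor <;> linarith
  let tot : Z → ℝ := fun x => ∑ᶠ i, σ i x
  have htotlo : ∀ x ∉ S, Metric.infDist x S / 2 ≤ tot x := fun x hx => by
    obtain ⟨i, hi⟩ := hcov x hx
    refine le_trans ?_ (single_le_finsum (⟨i, x, hi⟩ : ι) (hfin x hx) fun j => hσ0 j x)
    refine le_max_of_le_left ?_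
    rw [Metric.infDist_zero_of_mem hi, sub_zero]
  have htotpos : ∀ x ∉ S, 0 < tot x := fun x hx => (half_pos (hpos x hx)).trans_le (htotlo x hx)
  have htotlip : ∀ x ∉ S, ∀ y ∉ S, |tot x - tot y| ≤ 4 * N * dist x y := fun x hx y hy => by
    classical
    set F := (hfin x hx).toFinset ∪ (hfin y hy).toFinset
    have h1 : tot x = ∑ i ∈ F, σ i x :=
      finsum_eq_sum_of_support_subset _ fun i hi => by simp [F, Function.mem_support.1 hi]
    have h2 : tot y = ∑ i ∈ F, σ i y :=
      finsum_eq_sum_of_support_subset _ fun i hi => by simp [F, Function.mem_support.1 hi]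
    have hc : ∀ z (hz : z ∉ S), (hfin z hz).toFinset.card ≤ N := fun z hz => by
      have := hcard z hz
      rw [(hfin z hz).encard_eq_coe_toFinset_card] at this
      exact_mod_cast this
    have hF : (F.card : ℝ) ≤ 2 * N := by
      have h3 : F.card ≤ _ := Finset.card_union_le _ _
      have h4 := hc x hx
      have h5 := hc y hy
      exact_mod_cast (by omega : F.card ≤ 2 * N)
    rw [h1, h2, ← Finset.sum_sub_distrib]
    calc |∑ i ∈ F, (σ i x - σ i y)| ≤ ∑ i ∈ F, |σ i x - σ i y| := Finset.abs_sum_le_sum_abs _ _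
      _ ≤ F.card • (2 * dist x y) := Finset.sum_le_card_nsmul _ _ _ fun i _ => hσlip i x y
      _ = F.card * (2 * dist x y) := nsmul_eq_mul _ _
      _ ≤ 2 * N * (2 * dist x y) := by gcongr
      _ = 4 * N * dist x y := by ring
  have hsupp : ∀ x, (Function.support fun i => σ i x / tot x) ⊆ Function.support fun i => σ i x :=
    fun x i hi h0 => hi (by simp only [h0, zero_div])
  refine ⟨ι, ⟨{
    weight := fun i x => σ i x / tot x
    point := p
    card := N
    B := ⟨1 + 2 * A, by positivity⟩
    M := 4 + 8 * N
    point_mem := hpS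
    weight_nonneg := fun i x => div_nonneg (hσ0 i x) (finsum_nonneg fun j => hσ0 j x)
    finsum_weight := fun x hx => ?_
    encard_support_le := fun x hx => (encard_le_encard (hsupp x)).trans (hcard x hx)
    dist_point_le := fun x hx i hi => ?_
    abs_sub_le := fun x hx y hy i => ?_ }⟩⟩
  · simp only [div_eq_mul_inv]
    rw [← finsum_mul' _ _ (hfin x hx)]
    exact mul_inv_cancel₀ (htotpos x hx).ne'
  · obtain ⟨y, hy, hxy⟩ := hσne i x (hsupp x hi)
    have h1 := hpd i y hy
    have h2 := Metric.infDist_le_infDist_add_dist (s := S) (x := y) (y := x)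
    rw [dist_comm y x] at h2
    have h3 : A * Metric.infDist y S ≤ A * (2 * Metric.infDist x S) := by
      gcongr
      linarith [hpos x hx]
    have h4 := dist_triangle x y (p i)
    change _ ≤ (1 + 2 * A) * _
    linarith [hpos x hx]
  · have hX := htotpos x hx
    have hY := htotpos y hy
    have h1 := htotlo x hx
    have h2 := hσlip i x y
    have h3 := htotlip y hy x hx
    rw [dist_comm] at h3
    have hb : σ i y / tot y ≤ 1 := by
      rw [div_le_one hY]
      exact single_le_finsum i (hfin y hy) fun j => hσ0 j y
    have hb0 : 0 ≤ σ i y / tot y := div_nonneg (hσ0 i y) hY.le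
    -- Quotient rule: as `σ i y / tot y ≤ 1`, the Lipschitz constants 2 of `σ i` and `4 N` of `tot`
    -- add up. Dividing by `tot x ≥ infDist x S / 2` doubles them, whence `M = 4 + 8 N`.
    have hid : (σ i x / tot x - σ i y / tot y) * tot x =
        (σ i x - σ i y) + (σ i y / tot y) * (tot y - tot x) := by
      field_simp
      ring
    have h4 : |σ i x / tot x - σ i y / tot y| * tot x ≤ 2 * dist x y + 4 * N * dist x y := by
      rw [← abs_of_pos hX, ← abs_mul, abs_of_pos hX, hid]
      refine (abs_add_le _ _).trans (add_le_add h2 ?_)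
      rw [abs_mul, abs_of_nonneg hb0]
      exact (mul_le_of_le_one_left (abs_nonneg _) hb).trans h3
    have h5 := mul_le_mul_of_nonneg_left h1 (abs_nonneg (σ i x / tot x - σ i y / tot y))
    push_cast
    linarith

end Whitney

/-! ### The Whitney extension operator and its bounds. -/

namespace WhitneyPartition

variable {Z : Type*} [MetricSpace Z] {S : Set Z} {ι : Type*} (P : WhitneyPartition S ι)
  {V : Type*} [NormedAddCommGroup V] [NormedSpace ℝ V]

theorem finite_support {x : Z} (hx : x ∉ S) : (Function.support fun i => P.weight i x).Finite :=
  finite_of_encard_le_coe (P.encard_support_le x hx)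

theorem finite_support_smul {x : Z} (hx : x ∉ S) (v : ι → V) :
    (Function.support fun i => P.weight i x • v i).Finite :=
  (P.finite_support hx).subset fun i hi h0 => hi (by simp [Function.notMem_support.1 (not_not.2 h0)])

open Classical in
/-- The extension operator `f ↦ ∑ i, weight i • f (point i)` from `S` to the whole space. -/
noncomputable def extend : (Z → V) →ₗ[ℝ] (Z → V) where
  toFun f x := if x ∈ S then f x else ∑ᶠ i, P.weight i x • f (P.point i)
  map_add' f g := by
    ext x
    by_cases hx : x ∈ S
    · simp [hx]
    · simp only [hx, if_false, Pi.add_apply, smul_add]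
      exact finsum_add_distrib (P.finite_support_smul hx _) (P.finite_support_smul hx _)
  map_smul' c f := by
    ext x
    by_cases hx : x ∈ S
    · simp [hx]
    · simp only [hx, if_false, Pi.smul_apply, RingHom.id_apply]
      rw [smul_finsum' c (P.finite_support_smul hx fun i => f (P.point i))]
      exact finsum_congr fun i => smul_comm _ _ _

theorem extend_of_mem (f : Z → V) {x : Z} (hx : x ∈ S) : P.extend f x = f x := if_pos hx

theorem extend_of_notMem (f : Z → V) {x : Z} (hx : x ∉ S) :
    P.extend f x = ∑ᶠ i, P.weight i x • f (P.point i) := if_neg hx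

/-- Off `S` the extension is a convex combination of values of `f`, and balls are convex. -/
theorem extend_mem_closedBall (f : Z → V) {x : Z} (hx : x ∉ S) {v : V} {R : ℝ}
    (h : ∀ i, P.weight i x ≠ 0 → ‖f (P.point i) - v‖ ≤ R) : ‖P.extend f x - v‖ ≤ R := by
  rw [P.extend_of_notMem f hx, ← mem_closedBall_iff_norm]
  exact (convex_closedBall v R).finsum_mem (fun i => P.weight_nonneg i x) (P.finsum_weight x hx)
    fun i hi => mem_closedBall_iff_norm.2 (h i hi)

theorem norm_extend_le {f : Z → V} {R : ℝ} (h : ∀ x ∈ S, ‖f x‖ ≤ R) (x : Z) :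
    ‖P.extend f x‖ ≤ R := by
  by_cases hx : x ∈ S
  · rw [P.extend_of_mem f hx]
    exact h x hx
  · rw [← sub_zero (P.extend f x)]
    exact P.extend_mem_closedBall f hx fun i _ => by
      rw [sub_zero]
      exact h _ (P.point_mem i)

theorem dist_extend_of_mem {f : Z → V} {K : ℝ≥0} (hf : LipschitzOnWith K f S) {x a : Z}
    (hx : x ∉ S) (ha : a ∈ S) : dist (P.extend f x) (f a) ≤ K * (P.B + 1) * dist x a := by
  rw [dist_eq_norm]
  refine P.extend_mem_closedBall f hx fun i hi => ?_
  rw [← dist_eq_norm, mul_assoc]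
  refine (hf.dist_le_mul _ (P.point_mem i) _ ha).trans (mul_le_mul_of_nonneg_left ?_ K.coe_nonneg)
  have h1 := P.dist_point_le x hx i hi
  have h2 := dist_triangle_left (P.point i) a x
  have h3 : P.B * Metric.infDist x S ≤ P.B * dist x a :=
    mul_le_mul_of_nonneg_left (Metric.infDist_le_dist_of_mem ha) P.B.coe_nonneg
  linarith

/-- Both families of weights sum to 1, so subtracting `v` from all values leaves the difference
unchanged; at most `2 * card` indices contribute. -/
theorem extend_sub_extend (f : Z → V) {x y : Z} (hx : x ∉ S) (hy : y ∉ S) (v : V) {R : ℝ}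
    (hR : 0 ≤ R)
    (h : ∀ i, P.weight i x ≠ 0 ∨ P.weight i y ≠ 0 →
      |P.weight i x - P.weight i y| * ‖f (P.point i) - v‖ ≤ R) :
    ‖P.extend f x - P.extend f y‖ ≤ 2 * P.card * R := by
  classical
  set F := (P.finite_support hx).toFinset ∪ (P.finite_support hy).toFinset with hFdef
  have hsub : ∀ z, (z = x ∨ z = y) → (Function.support fun i => P.weight i z) ⊆ F := by
    rintro z (rfl | rfl) i hi <;> simp [hFdef, Function.mem_support.1 hi]
  have hsum : ∀ z (hz : z = x ∨ z = y), z ∉ S →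
      P.extend f z - v = ∑ i ∈ F, P.weight i z • (f (P.point i) - v) := fun z hz hzS => by
    have h1 : ∑ i ∈ F, P.weight i z = 1 := by
      rw [← P.finsum_weight z hzS]
      exact (finsum_eq_sum_of_support_subset _ (hsub z hz)).symm
    have h2 : P.extend f z = ∑ i ∈ F, P.weight i z • f (P.point i) := by
      rw [P.extend_of_notMem f hzS]
      refine finsum_eq_sum_of_support_subset _ fun i hi => hsub z hz fun h0 => hi ?_
      simp only [h0, zero_smul]
    simp only [smul_sub, Finset.sum_sub_distrib]
    rw [← Finset.sum_smul, h1, one_smul, h2]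
  have hc : ∀ z (hz : z ∉ S), (P.finite_support hz).toFinset.card ≤ P.card := fun z hz => by
    have := P.encard_support_le z hz
    rw [(P.finite_support hz).encard_eq_coe_toFinset_card] at this
    exact_mod_cast this
  have hF : (F.card : ℝ) ≤ 2 * P.card := by
    have h3 : F.card ≤ _ := Finset.card_union_le _ _
    have h4 := hc x hx
    have h5 := hc y hy
    exact_mod_cast (by omega : F.card ≤ 2 * P.card)
  rw [← sub_sub_sub_cancel_right _ _ v, hsum x (Or.inl rfl) hx, hsum y (Or.inr rfl) hy,
    ← Finset.sum_sub_distrib]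
  calc ‖∑ i ∈ F, (P.weight i x • (f (P.point i) - v) - P.weight i y • (f (P.point i) - v))‖
      ≤ ∑ i ∈ F, ‖P.weight i x • (f (P.point i) - v) - P.weight i y • (f (P.point i) - v)‖ :=
        norm_sum_le _ _
    _ ≤ F.card • R := by
        refine Finset.sum_le_card_nsmul _ _ _ fun i hi => ?_
        rw [← sub_smul, norm_smul, Real.norm_eq_abs]
        refine h i ?_
        simpa [hFdef] using hi
    _ = F.card * R := nsmul_eq_mul _ _
    _ ≤ 2 * P.card * R := by gcongr

/-- The Lipschitz constant of the extension operator. -/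
noncomputable def lipFactor : ℝ≥0 := 5 * (P.B + 1) + 2 * P.card * (P.M * (P.B + 3))

theorem dist_extend_le_of_infDist_le (hne : S.Nonempty) (hS : IsClosed S) {f : Z → V} {K : ℝ≥0}
    (hf : LipschitzOnWith K f S) {x y : Z} (hx : x ∉ S) (hy : y ∉ S)
    (hxy : Metric.infDist y S ≤ Metric.infDist x S) :
    dist (P.extend f x) (P.extend f y) ≤ P.lipFactor * K * dist x y := by
  have hr := (hS.notMem_iff_infDist_pos hne).1 hx
  obtain ⟨a, ha, hxa⟩ := (Metric.infDist_lt_iff hne).1 (lt_mul_of_one_lt_left hr one_lt_two)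
  have hd : 0 ≤ dist x y := dist_nonneg
  have hB := P.B.coe_nonneg
  have hM := P.M.coe_nonneg
  have hK := K.coe_nonneg
  have hfac : (P.lipFactor : ℝ) = 5 * (P.B + 1) + 2 * P.card * (P.M * (P.B + 3)) := by
    simp [lipFactor]
  have hya := dist_triangle_left y a x
  rw [hfac]
  -- If `x` and `y` are far apart relative to `S`, compare both with `f a`: `dist x a + dist y a` is
  -- at most `5 * dist x y`. Otherwise all relevant points lie within `(B + 3) * infDist x S` of
  -- `a`, and the variation of the weights gives the bound.
  rcases le_total (Metric.infDist x S) (dist x y) with h | h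
  · have h1 := P.dist_extend_of_mem hf hx ha
    have h2 := P.dist_extend_of_mem hf hy ha
    have h3 := dist_triangle_right (P.extend f x) (P.extend f y) (f a)
    calc dist (P.extend f x) (P.extend f y)
        ≤ K * (P.B + 1) * (dist x a + dist y a) := by linarith
      _ ≤ K * (P.B + 1) * (5 * dist x y) := by gcongr; linarith
      _ = 5 * (P.B + 1) * K * dist x y := by ring
      _ ≤ _ := by gcongr; exact le_add_of_nonneg_right (by positivity)
  · have hpt : ∀ i, P.weight i x ≠ 0 ∨ P.weight i y ≠ 0 →
        dist (P.point i) a ≤ (P.B + 3) * Metric.infDist x S := by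
      rintro i (hi | hi)
      · have h1 := P.dist_point_le x hx i hi
        have h2 := dist_triangle_left (P.point i) a x
        linarith
      · have h1 := P.dist_point_le y hy i hi
        have h2 := dist_triangle_left (P.point i) a y
        have h3 : P.B * Metric.infDist y S ≤ P.B * Metric.infDist x S := by gcongr
        linarith
    rw [dist_eq_norm]
    calc ‖P.extend f x - P.extend f y‖
        ≤ 2 * P.card * (P.M * (P.B + 3) * K * dist x y) := by
          refine P.extend_sub_extend f hx hy (f a) (by positivity) fun i hi => ?_
          calc |P.weight i x - P.weight i y| * ‖f (P.point i) - f a‖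
              ≤ |P.weight i x - P.weight i y| * (K * ((P.B + 3) * Metric.infDist x S)) := by
                rw [← dist_eq_norm]
                gcongr
                exact (hf.dist_le_mul _ (P.point_mem i) _ ha).trans (by gcongr; exact hpt i hi)
            _ = (|P.weight i x - P.weight i y| * Metric.infDist x S) * (K * (P.B + 3)) := by ring
            _ ≤ (P.M * dist x y) * (K * (P.B + 3)) := by
                exact mul_le_mul_of_nonneg_right (P.abs_sub_le x hx y hy i) (by positivity)
            _ = P.M * (P.B + 3) * K * dist x y := by ring
      _ = 2 * P.card * (P.M * (P.B + 3)) * K * dist x y := by ring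
      _ ≤ _ := by gcongr; exact le_add_of_nonneg_left (by positivity)

theorem lipschitzWith_extend (hne : S.Nonempty) (hS : IsClosed S) {f : Z → V} {K : ℝ≥0}
    (hf : LipschitzOnWith K f S) : LipschitzWith (P.lipFactor * K) (P.extend f) := by
  have hmix : ∀ x a, x ∉ S → a ∈ S →
      dist (P.extend f x) (P.extend f a) ≤ P.lipFactor * K * dist x a := fun x a hx ha => by
    rw [P.extend_of_mem f ha]
    refine (P.dist_extend_of_mem hf hx ha).trans ?_
    rw [mul_comm (K : ℝ)]
    gcongr
    have h1 : P.B + 1 ≤ P.lipFactor :=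
      (le_mul_of_one_le_left zero_le (by norm_num)).trans le_self_add
    exact_mod_cast h1
  refine LipschitzWith.of_dist_le_mul fun x y => ?_
  rw [NNReal.coe_mul]
  by_cases hx : x ∈ S <;> by_cases hy : y ∈ S
  · rw [P.extend_of_mem f hx, P.extend_of_mem f hy]
    refine (hf.dist_le_mul x hx y hy).trans ?_
    gcongr
    refine le_mul_of_one_le_left K.coe_nonneg ?_
    have h1 : 1 ≤ P.lipFactor := by
      refine le_trans ?_ (le_self_add (a := 5 * (P.B + 1)))
      exact one_le_mul (by norm_num) le_add_self
    exact_mod_cast h1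
  · rw [dist_comm, dist_comm x]
    exact hmix y x hy hx
  · exact hmix x y hx hy
  · rcases le_total (Metric.infDist y S) (Metric.infDist x S) with h | h
    · exact P.dist_extend_le_of_infDist_le hne hS hf hx hy h
    · rw [dist_comm, dist_comm x]
      exact P.dist_extend_le_of_infDist_le hne hS hf hy hx h

end WhitneyPartition

/-! ### Linear choice of representatives and the case of the complement. -/

section Assembly

variable {X : Type*} [MetricSpace X]

theorem lipConst_le {V : Type*} [NormedAddCommGroup V] {f : X → V} {K : ℝ≥0}
    (h : LipschitzWith K f) : lipConst f ≤ K := iInf₂_le K h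

theorem exists_mem_dist_le_of_subset {S T : Set X} (hS : IsClosed S) (hne : S.Nonempty)
    (hST : S ⊆ T) {x : X} (hx : x ∉ S) : ∃ t ∈ T, dist x t ≤ 2 * Metric.infDist x S := by
  obtain ⟨a, ha, hxa⟩ := (Metric.infDist_lt_iff hne).1
    (lt_mul_of_one_lt_left ((hS.notMem_iff_infDist_pos hne).1 hx) one_lt_two)
  exact ⟨a, hST ha, hxa.le⟩

variable [MeasurableSpace X]

/-- Under `LIP^∞ = W^{1,∞}` there is a linear choice of representatives of `W^{1,∞}(X; V)` that are
Lipschitz on the support of the measure, with control of the Lipschitz constant. -/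
theorem LipEqSobolev.exists_linear_representative [SecondCountableTopology X] [BorelSpace X]
    {μ : Measure X} (heq : LipEqSobolev μ) (V : Type*) [NormedAddCommGroup V] [NormedSpace ℝ V]
    [CompleteSpace V] :
    ∃ (R : sobolev μ V →ₗ[ℝ] (X → V)) (C : ℝ≥0), ∀ u : sobolev μ V,
      LipschitzOnWith (C * (sobolevNorm (u : Lp V ∞ μ)).toNNReal) (R u) μ.support ∧
      R u =ᵐ[μ] (u : Lp V ∞ μ) := by
  obtain ⟨C, hC⟩ := heq.exists_lipschitz_representative
  choose f hlip hf using fun u : sobolev μ V => hC u.1 u.2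
  have hcont : ∀ u, ContinuousOn (f u) μ.support := fun u => (hlip u).continuousOn
  refine ⟨{
    -- Setting the function to 0 off the support turns uniqueness on the support into linearity
    -- everywhere.
    toFun := fun u => μ.support.indicator (f u)
    map_add' := fun u v => ?_
    map_smul' := fun c u => ?_ }, C, fun u => ⟨?_, ?_⟩⟩
  · refine Eq.trans (indicator_congr ?_) (indicator_add' _ _ _)
    refine (eqOn_support_of_ae_eq (hcont _) ((hcont u).add (hcont v)) ?_)
    exact (hf _).trans ((Lp.coeFn_add _ _).trans ((hf u).add (hf v)).symm)
  · refine Eq.trans (indicator_congr ?_) (indicator_const_smul _ c _)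
    refine (eqOn_support_of_ae_eq (hcont _) ((hcont u).const_smul c) ?_)
    exact (hf _).trans ((Lp.coeFn_smul _ _).trans ((hf u).const_smul c).symm)
  · intro x hx y hy
    simp only [LinearMap.coe_mk, AddHom.coe_mk, indicator_of_mem hx, indicator_of_mem hy]
    exact hlip u hx hy
  · filter_upwards [hf u, Measure.support_mem_ae (μ := μ)] with x hx hxS
    exact (indicator_of_mem hxS _).trans hx

theorem lipNorm_le {μ : Measure X} {V : Type*} [NormedAddCommGroup V] {f : X → V} {K : ℝ≥0} {M : ℝ}
    (hf : LipschitzWith K f) (hM : ∀ x, ‖f x‖ ≤ M) : lipNorm μ f ≤ ENNReal.ofReal M + K := by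
  refine add_le_add ?_ (lipConst_le hf)
  rw [eLpNorm_exponent_top]
  exact eLpNormEssSup_le_of_ae_bound (ae_of_all _ hM)

/-- If balls have positive measure, then the complement of `Ω` is dense in the complement of the
support of the restricted measure. -/
theorem exists_notMem_dist_le [SecondCountableTopology X] [BorelSpace X] {μ : Measure X}
    (hμ : ∀ (z : X) (r : ℝ), 0 < r → 0 < μ (Metric.ball z r)) {Ω : Set X} (hΩ : MeasurableSet Ω)
    {x : X} (hx : 0 < Metric.infDist x (Subtype.val '' (restrictTo μ Ω).support)) :
    ∃ t ∈ Ωᶜ, dist x t ≤ 2 * Metric.infDist x (Subtype.val '' (restrictTo μ Ω).support) := by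
  set S := Subtype.val '' (restrictTo μ Ω).support
  -- Otherwise the ball around `x` of radius `infDist x S` lies in `Ω` and misses the support, so it
  -- is null, contrary to the positivity of balls.
  by_contra! hcon
  have hball : Metric.ball x (Metric.infDist x S) ⊆ Ω := fun t ht => by
    by_contra htΩ
    rw [Metric.mem_ball, dist_comm] at ht
    linarith [hcon t htΩ]
  have h0 : restrictTo μ Ω (Subtype.val ⁻¹' Metric.ball x (Metric.infDist x S)) = 0 := by
    refine measure_mono_null (t := (restrictTo μ Ω).supportᶜ) (fun y hy hyS => ?_)
      Measure.measure_compl_support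
    rw [mem_preimage, Metric.mem_ball, dist_comm] at hy
    exact hy.not_ge (Metric.infDist_le_dist_of_mem (mem_image_of_mem _ hyS))
  rw [restrictTo, (MeasurableEmbedding.subtype_coe hΩ).comap_apply, Subtype.image_preimage_coe,
    inter_eq_right.2 hball] at h0
  exact (hμ x _ hx).ne' h0

end Assembly

end MetricSobolev

/-! ### The extension theorem. -/

open MetricSobolev in
theorem mainTheorem9 {Z : Type*} [MetricSpace Z] [TopologicalSpace.SeparableSpace Z]
    [MeasurableSpace Z] [BorelSpace Z] (μ : MeasureTheory.Measure Z)
    (hμ : ∀ (z : Z) (r : ℝ), 0 < r → 0 < μ (Metric.ball z r) ∧ μ (Metric.ball z r) < ⊤)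
    (Ω : Set Z) (hΩ : IsComplete Ω)
    (heq : MetricSobolev.LipEqSobolev (MetricSobolev.restrictTo μ Ω))
    (hdim : MetricSobolev.nagataDim Ω < ⊤ ∨ MetricSobolev.nagataDim (Ωᶜ : Set Z) < ⊤)
    (V : Type*) [NormedAddCommGroup V] [NormedSpace ℝ V] [CompleteSpace V] :
    ∃ E : MetricSobolev.sobolev (MetricSobolev.restrictTo μ Ω) V →ₗ[ℝ] MetricSobolev.lip μ V,
      (∃ C : NNReal, ∀ u : MetricSobolev.sobolev (MetricSobolev.restrictTo μ Ω) V,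
        MetricSobolev.lipNorm μ (E u : Z → V) ≤
          C * MetricSobolev.sobolevNorm
            (u : MeasureTheory.Lp V ⊤ (MetricSobolev.restrictTo μ Ω))) ∧
      ∀ u : MetricSobolev.sobolev (MetricSobolev.restrictTo μ Ω) V,
        ∀ᵐ x : Ω ∂(MetricSobolev.restrictTo μ Ω),
          (E u : Z → V) x =
            (u : MeasureTheory.Lp V ⊤ (MetricSobolev.restrictTo μ Ω)) x := by
  have : SecondCountableTopology Z := UniformSpace.secondCountable_of_separable Z
  set ν := restrictTo μ Ω
  -- For the zero measure the support is empty and nothing has to be extended.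
  rcases eq_or_ne ν 0 with hν | hν
  · refine ⟨0, ⟨0, fun u => ?_⟩, fun u => ?_⟩
    · refine (lipNorm_le (K := 0) (M := 0) (LipschitzWith.const (0 : V)) fun x => by simp).trans ?_
      simp
    · exact (ae_eq_bot.2 hν).symm ▸ Filter.eventually_bot
  set S : Set Z := Subtype.val '' ν.support
  have hne : S.Nonempty := (Measure.nonempty_support hν).image _
  have hΩne : Nonempty Ω := ⟨(Measure.nonempty_support hν).some⟩
  have hS : IsClosed S :=
    hΩ.isClosed.isClosedEmbedding_subtypeVal.isClosedMap _ Measure.isClosed_support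
  have hpos : ∀ x ∉ S, 0 < Metric.infDist x S := fun x hx =>
    (hS.notMem_iff_infDist_pos hne).1 hx
  obtain ⟨ι, ⟨P⟩⟩ : ∃ ι, Nonempty (WhitneyPartition S ι) := by
    rcases hdim with h | h <;> obtain ⟨n, hn⟩ := exists_nagataDimLE h
    · exact exists_whitneyPartition hS hne hn fun x hx =>
        exists_mem_dist_le_of_subset hS hne (Subtype.coe_image_subset _ _) hx
    · exact exists_whitneyPartition hS hne hn fun x hx =>
        exists_notMem_dist_le (fun z r hr => (hμ z r hr).1) hΩ.isClosed.measurableSet (hpos x hx)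
  obtain ⟨R, C, hR⟩ := heq.exists_linear_representative V
  -- The values of `r` outside `Ω` are arbitrary; `P.extend` reads its argument only on `S ⊆ Ω`.
  let r : Z → Ω := Function.invFun Subtype.val
  have hr : ∀ x : Ω, r x = x := Function.leftInverse_invFun Subtype.val_injective
  let G : sobolev ν V →ₗ[ℝ] (Z → V) := P.extend ∘ₗ LinearMap.funLeft ℝ V r ∘ₗ R
  have hG : ∀ u, G u = P.extend (R u ∘ r) := fun u => rfl
  have hlip : ∀ u : sobolev ν V,
      LipschitzWith (P.lipFactor * (C * (sobolevNorm (u : Lp V ∞ ν)).toNNReal)) (G u) := fun u => by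
    rw [hG]
    refine P.lipschitzWith_extend hne hS ?_
    rintro _ ⟨x, hx, rfl⟩ _ ⟨y, hy, rfl⟩
    simp only [Function.comp_apply, hr]
    exact (hR u).1 hx hy
  have hsup : ∀ (u : sobolev ν V) x, ‖G u x‖ ≤ ‖(u : Lp V ∞ ν)‖ := fun u x => by
    rw [hG]
    refine P.norm_extend_le ?_ x
    rintro _ ⟨x, hx, rfl⟩
    simp only [Function.comp_apply, hr]
    exact norm_le_of_ae_eq_Lp (hR u).1.continuousOn (hR u).2 hx
  refine ⟨G.codRestrict (lip μ V) fun u => ⟨⟨_, hlip u⟩, ?_⟩, ⟨1 + P.lipFactor * C, fun u => ?_⟩,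
    fun u => ?_⟩
  · rw [eLpNorm_exponent_top]
    exact (eLpNormEssSup_le_of_ae_bound (Filter.Eventually.of_forall (hsup u))).trans_lt
      ENNReal.ofReal_lt_top
  · refine (lipNorm_le (hlip u) (hsup u)).trans ?_
    rw [ENNReal.coe_mul, ENNReal.coe_mul, ENNReal.coe_toNNReal (sobolevNorm_lt_top u.2).ne,
      ENNReal.coe_add, ENNReal.coe_one, ENNReal.coe_mul, add_mul, one_mul, mul_assoc, ofReal_norm]
    gcongr
    rw [sobolevNorm_eq_enorm_add]
    exact le_self_add
  · filter_upwards [(hR u).2, Measure.support_mem_ae (μ := ν)] with x hx hxS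
    change G u x = _
    rw [hG, P.extend_of_mem _ (mem_image_of_mem _ hxS),
      Function.comp_apply, hr, hx]
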